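/- **Model.** There are $n$ products; $N=[n]\cup\{\varnothing\}$ is the set of purchase options, where $\varnothing$ is the no-purchase option. A top-$k$ list $\tau$ over $N$ strictly orders $k$ options $\tau(1)\succ\dots\succ\tau(k)$; the remaining options (the set $\bar\tau$) are ranked below these and are mutually incomparable. Let $\tau^*$ be a top-$k$ list (the center) and let $\beta\ge 0$, $p>0$, $w_0\ge 0$, $w_1,\dots,w_k\ge 0$. For a top-$k$ list $\tau$ put, writing $c_i=\tau^*(i)$, $$I_i(\tau)=\#\{j: c_i\succ_{\tau^*}j,\ j\succ_\tau c_i\},\qquad P_i(\tau)=\#\{j: c_i\succ_{\tau^*}j,\ c_i,j\in\bar\tau\},\qquad Q(\tau)=\binom{k-|\tau\cap\tau^*|}{2},$$ and let $\mathcal D$ be the probability distribution on top-$k$ lists with $$\Pr(\tau)\propto\exp\Bigl(-\beta\bigl(w_0\,p\,Q(\tau)+\sum_{i=1}^k w_i\,(I_i(\tau)+p\,P_i(\tau))\bigr)\Bigr).$$ When an assortment $A\subseteq[n]$ is shown to a customer, a fresh $\tau\sim\mathcal D$ is drawn and the customer chooses the element of $A\cup\{\varnothing\}$ ranked highest by $\tau$,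 or a uniformly random element of $A\cup\{\varnothing\}$ if all of them are in $\bar\tau$. Let $w_{\min}=\min_{1\le i\le k}w_i$. **Algorithm.** $\textsc{FindTop}(A,(c_1,\dots,c_m))$ returns an $a\in A\cup\{\varnothing\}$ with $\frac1m\bigl(\#\{t:c_t=a\}-\#\{t:c_t=b\}\bigr)>\frac{1}{2(1+|A|)}$ for all $b\in (A\cup\{\varnothing\})\setminus\{a\}$, and None if there is none. $\textsc{BuCChoi}$ gets the set of products, the assortment size $r$ and a number of samples $m$. It starts with $T=B=\emptyset$, $U=[n]$. While $U\ne\emptyset$ it takes an assortment $A$ of $r$ elements of $U$ (if $|U|<r$: all of $U$, filled up from $B$ as far as possible), shows $A$ to $m$ customers and applies FindTop to the choices; if a product $a$ is returned, $a$ is added to $T$ and removed from $U$, otherwise $A$ is added to $B$ and removed from $U$. It then outputs $|T|$ as the size of the center, and sorts $T$: $|T|$ times, it determines the top element of the products not yet sorted and moves it to the end of the output list. The top element is found by a tournament, in each round of which the remaining candidates are divided into disjoint assortments of size $r$ (the last one filled up from $B$), each assortment is shown to $m$ customers, and the products returned by FindTop go on to the next round, until one is left. (To make every run finite, the main loop is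 stopped after $n$ iterations and a tournament on $t$ products after $t$ rounds; error-free runs never need more.) All free choices of subsets may be made in any way. **Theorem.** There are constants $c,C>0$ and a number of samples $m=m(n,r)$, depending only on $n$ and $r$, with $c\,r^2\log n\le m(n,r)\le C\,r^2\log n$ for all $n,r\ge2$, i.e. $m(n,r)=\Theta(r^2\log n)$, such that the following holds. For every $p>0$ there is a function $\varepsilon$ with $\varepsilon(s)\to0$ as $s\to\infty$ such that for all $r\ge2$, all $1\le k\le n$, and every model as above with this $p$, with $n$ products, with $w_{\min}>0$ and $\beta\ge\log 3/w_{\min}$, and with a center $\tau^*$ of size $k$ that does not contain $\varnothing$: with probability at least $1-\varepsilon(n-k)$, $\textsc{BuCChoi}$, given only the products, $r$ and $m=m(n,r)$, outputs exactly $k$ and the ordered list $\tau^*$, where each assortment it queries has at most $r$ products and is shown to exactly $m(n,r)$ customers. In particular, for fixed $p$ and $k$ (more generally, for fixed $p$ and $k=k(n)$ with $n-k\to\infty$) the probability of success is $1-o(1)$ as $n\to\infty$, uniformly in $r$, $\tau^*$, $\beta$ and the weights. -/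

import Mathlib

noncomputable section

namespace TopKChoice

/-- The purchase options: `n` products together with the no-purchase option `none`. -/
abbrev Item (n : ℕ) : Type := Option (Fin n)

/-- A top-`k` list over the purchase options; `τ l` is the option at position `l`
(position `0` is the best). Options outside the range of `τ` are mutually incomparable and
ranked below all listed ones. -/
abbrev TopList (k n : ℕ) : Type := Fin k ↪ Item n

/-- `x` is one of the `k` ranked options of `τ`. -/
def Ranked {k n : ℕ} (τ : TopList k n) (x : Item n) : Prop := ∃ l, τ l = x

/-- `x ≻_τ y`: `x` is ranked, and `y` is unranked or ranked at a later position. -/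
def Above {k n : ℕ} (τ : TopList k n) (x y : Item n) : Prop :=
  ∃ l, τ l = x ∧ ∀ l', τ l' = y → l < l'

open Classical in
/-- The component `I_i(τ)`: the number of options `j` below the `i`-th centre element in the centre
`σ` that `τ` ranks above it. -/
def invI {k n : ℕ} (σ τ : TopList k n) (i : Fin k) : ℕ :=
  (Finset.univ.filter fun j : Item n => Above σ (σ i) j ∧ Above τ j (σ i)).card

open Classical in
/-- The component `P_i(τ)`: the number of options `j` below the `i`-th centre element in the centre
`σ` such that both are unranked in `τ`. -/
def invP {k n : ℕ} (σ τ : TopList k n) (i : Fin k) : ℕ :=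
  (Finset.univ.filter fun j : Item n =>
    Above σ (σ i) j ∧ ¬ Ranked τ (σ i) ∧ ¬ Ranked τ j).card

open Classical in
/-- The component `Q(τ)`: `k - ℓ` choose `2`, where `ℓ` is the number of options ranked by both
lists. -/
def invQ {k n : ℕ} (σ τ : TopList k n) : ℕ :=
  (k - (Finset.univ.filter fun x : Item n => Ranked σ x ∧ Ranked τ x).card).choose 2

/-- The parameters of a generalized Mallows model on top-`k` lists. The weight `w i` belongs to
the centre element at position `i`, the weight `w₀` to the options outside the centre. -/
structure TopKGMM (n k : ℕ) where
  center : TopList k n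
  β : ℝ
  p : ℝ
  w₀ : ℝ
  w : Fin k → ℝ
  β_nonneg : 0 ≤ β
  p_pos : 0 < p
  w₀_nonneg : 0 ≤ w₀
  w_nonneg : ∀ i, 0 ≤ w i

namespace TopKGMM

variable {n k : ℕ} (M : TopKGMM n k)

/-- The weighted distance of `τ` from the centre. -/
def dist (τ : TopList k n) : ℝ :=
  M.w₀ * M.p * (invQ M.center τ : ℝ) +
    ∑ i, M.w i * ((invI M.center τ i : ℝ) + M.p * (invP M.center τ i : ℝ))

/-- The unnormalized probability of `τ`. -/
def weight (τ : TopList k n) : ENNReal := ENNReal.ofReal (Real.exp (-M.β * M.dist τ))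

theorem tsum_weight_ne_zero : ∑' τ, M.weight τ ≠ 0 := by
  intro h
  have h1 := ENNReal.tsum_eq_zero.mp h M.center
  have h2 : (0 : ENNReal) < M.weight M.center := ENNReal.ofReal_pos.mpr (Real.exp_pos _)
  exact h2.ne' h1

theorem tsum_weight_ne_top : ∑' τ, M.weight τ ≠ ⊤ := by
  rw [tsum_fintype]
  exact ENNReal.sum_ne_top.mpr fun τ _ => ENNReal.ofReal_ne_top

/-- The distribution on top-`k` lists with probability proportional to `exp (-β * dist τ)`. -/
def law : PMF (TopList k n) :=
  PMF.normalize M.weight M.tsum_weight_ne_zero M.tsum_weight_ne_top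

/-- The least weight of a centre element (a minimum as soon as `0 < k`). -/
def wMin : ℝ := ⨅ i, M.w i

end TopKGMM

/-- An assortment together with the no-purchase option. -/
def withNull {n : ℕ} (A : Finset (Fin n)) : Finset (Item n) := Finset.insertNone A

theorem withNull_nonempty {n : ℕ} (A : Finset (Fin n)) : (withNull A).Nonempty :=
  ⟨none, Finset.none_mem_insertNone⟩

/-- `x` is the highest ranked element of `S` with respect to `τ`. -/
def IsTop {k n : ℕ} (τ : TopList k n) (S : Finset (Item n)) (x : Item n) : Prop :=
  x ∈ S ∧ ∀ y ∈ S, y ≠ x → Above τ x y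

open Classical in
/-- The choice of a customer with preferences `τ` from the assortment `A`: the highest ranked
element of `A ∪ {none}`, or a uniformly random one if all of them are incomparable. -/
def choose {k n : ℕ} (τ : TopList k n) (A : Finset (Fin n)) : PMF (Item n) :=
  if h : ∃ x, IsTop τ (withNull A) x then PMF.pure h.choose
  else PMF.uniformOfFinset (withNull A) (withNull_nonempty A)

/-- The choice oracle of a model: a fresh customer is drawn and shown the assortment `A`. -/
def TopKGMM.oracle {n k : ℕ} (M : TopKGMM n k) (A : Finset (Fin n)) : PMF (Item n) :=
  M.law.bind fun τ => choose τ A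

/-- `m` independent samples. -/
def samples {α : Type} (d : PMF α) : ℕ → PMF (List α)
  | 0 => PMF.pure []
  | m + 1 => d.bind fun x => (samples d m).bind fun xs => PMF.pure (x :: xs)

/-- For `a ≠ b`: the number of samples equal to `a` minus the number of samples equal to `b`. -/
def pairScore {n : ℕ} (S : List (Item n)) (a b : Item n) : ℤ :=
  (S.map fun c => if c = a then (1 : ℤ) else if c = b then -1 else 0).sum

/-- The test used by `findTop`: the average score of `a` against every other element of
`A ∪ {none}` exceeds `1 / (2 * (1 + |A|))`. -/
def Beats {n : ℕ} (A : Finset (Fin n)) (S : List (Item n)) (a : Item n) : Prop :=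
  a ∈ withNull A ∧ ∀ b ∈ withNull A, b ≠ a →
    1 / (2 * (1 + (A.card : ℝ))) < (pairScore S a b : ℝ) / (S.length : ℝ)

open Classical in
/-- `FindTop`. The outer `none` means that no element passes the test, `some none` that the
no-purchase option does. -/
def findTop {n : ℕ} (A : Finset (Fin n)) (S : List (Item n)) : Option (Item n) :=
  if h : ∃ a, Beats A S a then some h.choose else none

/-- A rule that selects, from any set `U`, a subset with `j` elements (all of `U` if it has
fewer). It resolves the free choices of the algorithm. -/
structure Selector (n : ℕ) where
  pick : ℕ → Finset (Fin n) → Finset (Fin n)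
  pick_subset : ∀ j U, pick j U ⊆ U
  card_pick : ∀ j U, (pick j U).card = min j U.card

/-- An assortment of size `r` from `U`, filled up with elements of `B` if `U` has fewer than `r`
elements (as far as `B` permits). -/
def assortment {n : ℕ} (sel : Selector n) (r : ℕ) (U B : Finset (Fin n)) : Finset (Fin n) :=
  sel.pick r U ∪ sel.pick (r - (sel.pick r U).card) B

/-- The collected choice data: the assortments in the order in which they were queried, each with
the choices observed in that query. -/
abbrev ChoiceData (n : ℕ) : Type := List (Finset (Fin n) × List (Item n))

/-- The state of the main loop: `T` holds the centre elements found, `B` the products found to be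
outside the centre, `U` the undecided products. -/
structure BuildState (n : ℕ) where
  T : Finset (Fin n)
  B : Finset (Fin n)
  U : Finset (Fin n)
  data : ChoiceData n

/-- The main loop, until `U = ∅`. The first argument bounds the number of iterations; `n`
iterations suffice, unless an element that was already decided is returned once more.
If the no-purchase option is the top element, no product of `A` lies above it and the products
of `A` are discarded as if `findTop` had returned `none`. -/
def buildLoop {n : ℕ} (O : Finset (Fin n) → PMF (Item n)) (sel : Selector n) (r m : ℕ) :
    ℕ → BuildState n → PMF (BuildState n)
  | 0, s => PMF.pure s
  | fuel + 1, s =>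
    if s.U = ∅ then PMF.pure s
    else
      let A := assortment sel r s.U s.B
      (samples (O A) m).bind fun S =>
        match findTop A S with
        | some (some a) =>
          buildLoop O sel r m fuel
            { T := insert a s.T, B := s.B, U := s.U.erase a, data := s.data ++ [(A, S)] }
        | _ =>
          buildLoop O sel r m fuel
            { T := s.T, B := s.B ∪ A, U := s.U \ A, data := s.data ++ [(A, S)] }

/-- One round of the tournament: `rest` is divided into disjoint assortments of size `r` (the last
one filled up from `B`), and the products returned by `findTop` are collected in `won`.
The first argument bounds the number of assortments; `|rest|` suffices. -/
def tourRound {n : ℕ} (O : Finset (Fin n) → PMF (Item n)) (sel : Selector n) (r m : ℕ)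
    (B : Finset (Fin n)) :
    ℕ → Finset (Fin n) → Finset (Fin n) → ChoiceData n → PMF (Finset (Fin n) × ChoiceData n)
  | 0, _, won, D => PMF.pure (won, D)
  | fuel + 1, rest, won, D =>
    if rest = ∅ then PMF.pure (won, D)
    else
      let A := assortment sel r rest B
      (samples (O A) m).bind fun S =>
        match findTop A S with
        | some (some a) =>
          tourRound O sel r m B fuel (rest \ sel.pick r rest) (insert a won) (D ++ [(A, S)])
        | _ =>
          tourRound O sel r m B fuel (rest \ sel.pick r rest) won (D ++ [(A, S)])

/-- The tournament: rounds are repeated until a single product is left. The first argument bounds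
the number of rounds; `|T|` rounds suffice for `2 ≤ r`. -/
def tournament {n : ℕ} (O : Finset (Fin n) → PMF (Item n)) (sel : Selector n) (r m : ℕ)
    (B : Finset (Fin n)) :
    ℕ → Finset (Fin n) → ChoiceData n → PMF (Finset (Fin n) × ChoiceData n)
  | 0, T, D => PMF.pure (T, D)
  | fuel + 1, T, D =>
    (tourRound O sel r m B T.card T ∅ D).bind fun x =>
      if x.1.card = 1 then PMF.pure x else tournament O sel r m B fuel x.1 x.2

/-- `SortCntr`: the top element of `U` is found by a tournament, appended to the output and
removed from `U`, as many times as the first argument says. -/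
def sortCntr {n : ℕ} (O : Finset (Fin n) → PMF (Item n)) (sel : Selector n) (r m : ℕ)
    (B : Finset (Fin n)) :
    ℕ → Finset (Fin n) → List (Fin n) → ChoiceData n → PMF (List (Fin n) × ChoiceData n)
  | 0, _, acc, D => PMF.pure (acc, D)
  | j + 1, U, acc, D =>
    (tournament O sel r m B U.card U D).bind fun x =>
      sortCntr O sel r m B j (U \ x.1) (acc ++ x.1.toList) x.2

/-- The output of the algorithm: the size of the centre, the centre (best element first), and the
choice data that were collected. -/
structure Output (n : ℕ) where
  size : ℕ
  center : List (Fin n)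
  data : ChoiceData n

/-- `BuCChoi`. It accesses the model only through the choice oracle `O`; `r` is the assortment
size, and every queried assortment is shown to `m` customers. -/
def bucchoi {n : ℕ} (O : Finset (Fin n) → PMF (Item n)) (sel : Selector n) (r m : ℕ) :
    PMF (Output n) :=
  (buildLoop O sel r m n { T := ∅, B := ∅, U := Finset.univ, data := [] }).bind fun s =>
    (sortCntr O sel r m s.B s.T.card s.T [] s.data).bind fun x =>
      PMF.pure { size := s.T.card, center := x.1, data := x.2 }

end TopKChoice

end

/-! The proof shows that one query is answered wrongly with probability at most `1 / n ^ 8`. With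
only correct answers the algorithm is a deterministic search that returns the centre after at most
`n + n ^ 3` queries, so a union bound over adaptive queries finishes the proof.

Suppose an assortment contains a centre element and let `c_i` be its highest one. It is chosen by
every customer whose list ranks `c_i` and has `I_i = 0`. These lists have probability at least
`0.66`, for two reasons. First, among the lists that rank `c_i`, exchanging `c_i` with the nearest
option above it that belongs below it is injective, lowers `I_i` by one and raises no other
component. Since `β w_i ≥ log 3`, the weight of the level `I_i = t` decays like `3 ^ (-t)`
(`rankedWt_succ_le`), so level `0` carries at least two thirds of the ranked weight. Second, lists
with an unranked centre element have at most one percent of the weight once `n - k` is large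
(`sum_unranked_le`): exchanging the last unranked centre element with the first listed option
outside the centre saves a distance proportional to `n - k`. A Chernoff bound then turns `0.66` into
a win for `c_i` (`failLE_beats`).

Suppose instead that the assortment contains no centre element. The no-purchase option is also
outside the centre, and relabelling outside options preserves the law, so each product is exactly as
likely as no purchase (`oracle_eq_of_outside`). Beating it by the margin `1 / (2 * (1 + |A|))` is
then a large deviation (`failLE_not_beats`); this is the source of the factor `r ^ 2` in the sample
size.

When `n - k` is too small for the one percent bound, the error function is `1` and nothing has to be
shown. -/

namespace TopKChoice

open Finset

/-! ### Positions in a list, exchanges of two options, and their effect on the distance components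
-/

section Positions

variable {k n : ℕ}

open Classical in
/-- The position of `x` in `τ`, with the value `k` if `x` is unranked. -/
noncomputable def pos (τ : TopList k n) (x : Item n) : ℕ :=
  if h : ∃ l, τ l = x then (h.choose : Fin k) else k

theorem pos_apply (τ : TopList k n) (l : Fin k) : pos τ (τ l) = l := by
  have h : ∃ l', τ l' = τ l := ⟨l, rfl⟩
  rw [pos, dif_pos h, τ.injective h.choose_spec]

theorem pos_of_not_ranked {τ : TopList k n} {x : Item n} (h : ¬ Ranked τ x) : pos τ x = k :=
  dif_neg h

theorem pos_le (τ : TopList k n) (x : Item n) : pos τ x ≤ k := by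
  by_cases h : Ranked τ x
  · obtain ⟨l, rfl⟩ := h
    rw [pos_apply]; exact l.2.le
  · exact (pos_of_not_ranked h).le

theorem ranked_iff {τ : TopList k n} {x : Item n} : Ranked τ x ↔ pos τ x < k := by
  constructor
  · rintro ⟨l, rfl⟩
    rw [pos_apply]; exact l.2
  · intro h
    by_contra h'
    exact h.ne (pos_of_not_ranked h')

theorem exists_of_pos_lt {τ : TopList k n} {x : Item n} (h : pos τ x < k) :
    τ ⟨pos τ x, h⟩ = x := by
  obtain ⟨l, rfl⟩ := ranked_iff.2 h
  congr 1
  exact Fin.ext (pos_apply τ l)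

theorem eq_of_pos_eq {τ : TopList k n} {x y : Item n} (h : pos τ x = pos τ y)
    (hx : pos τ x < k) : x = y := by
  rw [← exists_of_pos_lt hx, ← exists_of_pos_lt (h ▸ hx : pos τ y < k)]
  congr 1
  exact Fin.ext h

/-- The default position `k` exceeds every genuine position and is shared by all unranked options,
so it encodes both that they come last and that they are mutually incomparable. -/
theorem above_iff {τ : TopList k n} {x y : Item n} : Above τ x y ↔ pos τ x < pos τ y := by
  constructor
  · rintro ⟨l, rfl, h⟩
    rw [pos_apply]
    by_cases hy : Ranked τ y
    · obtain ⟨l', rfl⟩ := hy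
      rw [pos_apply]; exact h l' rfl
    · rw [pos_of_not_ranked hy]; exact l.2
  · intro h
    obtain ⟨l, rfl⟩ := ranked_iff.2 (h.trans_le (pos_le τ y))
    refine ⟨l, rfl, ?_⟩
    rintro l' rfl
    rw [pos_apply, pos_apply] at h
    exact h

/-- The list `τ` with the labels `a` and `b` exchanged. -/
def swapList (τ : TopList k n) (a b : Item n) : TopList k n :=
  τ.trans (Equiv.swap a b).toEmbedding

theorem swapList_swapList (τ : TopList k n) (a b : Item n) :
    swapList (swapList τ a b) a b = τ := by
  ext1 l
  simp [swapList]

theorem pos_swapList (τ : TopList k n) (a b x : Item n) :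
    pos (swapList τ a b) x = pos τ (Equiv.swap a b x) := by
  by_cases h : Ranked τ (Equiv.swap a b x)
  · obtain ⟨l, hl⟩ := h
    have : x = swapList τ a b l := by simp [swapList, hl]
    rw [← hl, this, pos_apply, pos_apply]
  · rw [pos_of_not_ranked h, pos_of_not_ranked]
    rintro ⟨l, rfl⟩
    exact h ⟨l, by simp [swapList]⟩

theorem pos_swapList_left (τ : TopList k n) (a b : Item n) :
    pos (swapList τ a b) a = pos τ b := by rw [pos_swapList, Equiv.swap_apply_left]

theorem pos_swapList_right (τ : TopList k n) (a b : Item n) :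
    pos (swapList τ a b) b = pos τ a := by rw [pos_swapList, Equiv.swap_apply_right]

theorem pos_swapList_of_ne (τ : TopList k n) {a b x : Item n} (ha : x ≠ a) (hb : x ≠ b) :
    pos (swapList τ a b) x = pos τ x := by rw [pos_swapList, Equiv.swap_apply_of_ne_of_ne ha hb]

theorem invI_eq (σ τ : TopList k n) (i : Fin k) :
    invI σ τ i = #{j : Item n | i.1 < pos σ j ∧ pos τ j < pos τ (σ i)} := by
  unfold invI
  congr 1
  ext j
  simp [above_iff, pos_apply]

theorem invP_eq (σ τ : TopList k n) (i : Fin k) :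
    invP σ τ i = #{j : Item n | i.1 < pos σ j ∧ ¬ pos τ (σ i) < k ∧ ¬ pos τ j < k} := by
  unfold invP
  congr 1
  ext j
  simp [above_iff, pos_apply, ranked_iff]

theorem invP_of_ranked {σ τ : TopList k n} {i : Fin k} (h : pos τ (σ i) < k) :
    invP σ τ i = 0 := by
  rw [invP_eq, card_eq_zero, filter_eq_empty_iff]
  tauto

theorem invQ_le {σ τ τ' : TopList k n}
    (h : ∀ x, pos σ x < k → pos τ x < k → pos τ' x < k) : invQ σ τ' ≤ invQ σ τ := by
  unfold invQ
  refine Nat.choose_le_choose _ (Nat.sub_le_sub_left (card_le_card ?_) _)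
  intro x
  simp only [mem_filter, mem_univ, true_and, ranked_iff]
  exact fun hx => ⟨hx.1, h x hx.1 hx.2⟩

theorem pos_swap_lt_iff {σ : TopList k n} {a b : Item n} {d : ℕ} (ha : d < pos σ a)
    (hb : d < pos σ b) (x : Item n) : d < pos σ (Equiv.swap a b x) ↔ d < pos σ x := by
  by_cases h1 : x = a
  · subst h1; simp [ha, hb]
  by_cases h2 : x = b
  · subst h2; simp [ha, hb]
  rw [Equiv.swap_apply_of_ne_of_ne h1 h2]

/-- If both exchanged options lie below `σ d` in the centre, the exchange permutes the candidates
counted for `d` and leaves `σ d` in place, so it is a bijection of the counted sets. -/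
theorem invI_swapList {σ : TopList k n} (τ : TopList k n) {a b : Item n} {d : Fin k}
    (ha : d.1 < pos σ a) (hb : d.1 < pos σ b) :
    invI σ (swapList τ a b) d = invI σ τ d := by
  have h1 : σ d ≠ a := by rintro rfl; simp [pos_apply] at ha
  have h2 : σ d ≠ b := by rintro rfl; simp [pos_apply] at hb
  rw [invI_eq, invI_eq]
  refine card_equiv (Equiv.swap a b) fun x => ?_
  simp [pos_swapList, Equiv.swap_apply_of_ne_of_ne h1 h2, pos_swap_lt_iff ha hb]

theorem invP_swapList {σ : TopList k n} (τ : TopList k n) {a b : Item n} {d : Fin k}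
    (ha : d.1 < pos σ a) (hb : d.1 < pos σ b) :
    invP σ (swapList τ a b) d = invP σ τ d := by
  have h1 : σ d ≠ a := by rintro rfl; simp [pos_apply] at ha
  have h2 : σ d ≠ b := by rintro rfl; simp [pos_apply] at hb
  rw [invP_eq, invP_eq]
  refine card_equiv (Equiv.swap a b) fun x => ?_
  simp [pos_swapList, Equiv.swap_apply_of_ne_of_ne h1 h2, pos_swap_lt_iff ha hb]

/-- `x` is the last element of `τ` among those below the centre element `σ i` in `σ` and above it
in `τ`. -/
def IsPred (σ τ : TopList k n) (i : Fin k) (x : Item n) : Prop :=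
  i.1 < pos σ x ∧ pos τ x < pos τ (σ i) ∧
    ∀ j, i.1 < pos σ j → pos τ j < pos τ (σ i) → pos τ j ≤ pos τ x

theorem exists_isPred {σ τ : TopList k n} {i : Fin k} (h : 0 < invI σ τ i) :
    ∃ x, IsPred σ τ i x := by
  rw [invI_eq, card_pos] at h
  obtain ⟨x, hx, hmax⟩ := exists_max_image _ (pos τ) h
  simp only [mem_filter, mem_univ, true_and] at hx hmax
  exact ⟨x, hx.1, hx.2, fun j h1 h2 => hmax j ⟨h1, h2⟩⟩

namespace IsPred

variable {σ τ : TopList k n} {i : Fin k} {x : Item n}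

theorem ne (h : IsPred σ τ i x) : x ≠ σ i := by
  rintro rfl
  exact lt_irrefl _ h.2.1

/-- After the exchange `σ i` sits at the old position of `x`. By maximality of `x`, the wrongly
placed options still above it are the former ones except `x`. -/
theorem invI_swap (h : IsPred σ τ i x) :
    invI σ (swapList τ (σ i) x) i + 1 = invI σ τ i := by
  rw [invI_eq, invI_eq]
  have hx : x ∈ ({j : Item n | i.1 < pos σ j ∧ pos τ j < pos τ (σ i)} : Finset _) := by
    simp [h.1, h.2.1]
  rw [← card_erase_add_one hx]
  congr 2
  ext j
  simp only [mem_filter, mem_univ, true_and, mem_erase, pos_swapList_left]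
  by_cases hj : j = x
  · subst hj
    simp only [pos_swapList_right]
    have := h.2.1
    simp; omega
  by_cases hj' : j = σ i
  · subst hj'
    simp [pos_apply]
  rw [pos_swapList_of_ne _ hj' hj]
  constructor
  · rintro ⟨h1, h2⟩
    exact ⟨hj, h1, h2.trans h.2.1⟩
  · rintro ⟨-, h1, h2⟩
    refine ⟨h1, lt_of_le_of_ne (h.2.2 j h1 h2) fun he => hj ?_⟩
    exact eq_of_pos_eq he (h2.trans_le (pos_le _ _))

theorem ranked_swap (h : IsPred σ τ i x) (hr : pos τ (σ i) < k) (z : Item n) :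
    pos (swapList τ (σ i) x) z < k ↔ pos τ z < k := by
  have := h.2.1
  by_cases h1 : z = σ i
  · subst h1; rw [pos_swapList_left]; omega
  by_cases h2 : z = x
  · subst h2; rw [pos_swapList_right]; omega
  rw [pos_swapList_of_ne _ h1 h2]

theorem invP_swap (h : IsPred σ τ i x) (hr : pos τ (σ i) < k) (d : Fin k) :
    invP σ (swapList τ (σ i) x) d = invP σ τ d := by
  simp only [invP_eq, h.ranked_swap hr]

/-- For `d` before `i`, both exchanged options lie below `σ d` and nothing changes. For `d` after
`i`, `σ i` is never counted. Either `x` moves down, which creates no inversion, or `σ d` is `x`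
itself; then an option newly above it would lie between `x` and `σ i` in `τ`, against maximality. -/
theorem invI_swap_le (h : IsPred σ τ i x) (d : Fin k) (hd : d ≠ i) :
    invI σ (swapList τ (σ i) x) d ≤ invI σ τ d := by
  have hd' : d.1 ≠ i.1 := fun e => hd (Fin.ext e)
  rcases lt_or_gt_of_ne hd' with hlt | hgt
  · refine (invI_swapList τ (by rw [pos_apply]; exact hlt) ?_).le
    have := h.1
    omega
  · rw [invI_eq, invI_eq]
    refine card_le_card fun j => ?_
    simp only [mem_filter, mem_univ, true_and]
    rintro ⟨h1, h2⟩
    refine ⟨h1, ?_⟩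
    have hj : j ≠ σ i := by rintro rfl; rw [pos_apply] at h1; omega
    have hdi : σ d ≠ σ i := fun e => hd (σ.injective e)
    by_cases hdx : σ d = x
    · have hjx : j ≠ x := by rintro rfl; rw [← hdx, pos_apply] at h1; omega
      rw [pos_swapList_of_ne _ hj hjx, hdx, pos_swapList_right] at h2
      rw [hdx]
      exact lt_of_le_of_ne (h.2.2 j (by omega) h2) fun he =>
        hjx (eq_of_pos_eq he (h2.trans_le (pos_le _ _)))
    · rw [pos_swapList_of_ne _ hdi hdx] at h2
      by_cases hjx : j = x
      · subst hjx
        rw [pos_swapList_right] at h2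
        exact h.2.1.trans h2
      · rwa [pos_swapList_of_ne _ hj hjx] at h2

/-- The exchange is reversible: in the new list, `x` is the first option after `σ i` that lies below
`σ i` in the centre. Hence the image determines `x`, and then the original list. -/
theorem eq_of_swap_eq {τ₂ : TopList k n} {y : Item n} (h : IsPred σ τ i x)
    (hr : pos τ (σ i) < k) (h₂ : IsPred σ τ₂ i y) (e : swapList τ (σ i) x = swapList τ₂ (σ i) y) : τ = τ₂ := by
  -- If `y` came before `x` in the common image, it would have kept its place in `τ`, hence by
  -- maximality of `x` lie no later than the new place of `σ i`; but the second description puts it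
  -- after that place.
  have key : ∀ {τ τ₂ : TopList k n} {x y : Item n}, IsPred σ τ i x → IsPred σ τ₂ i y →
      swapList τ (σ i) x = swapList τ₂ (σ i) y →
      pos (swapList τ (σ i) x) x ≤ pos (swapList τ (σ i) x) y := by
    intro τ τ₂ x y h h₂ e
    by_contra! hlt
    have hxy : y ≠ x := by rintro rfl; exact lt_irrefl _ hlt
    have h3 : pos (swapList τ (σ i) x) y = pos τ₂ (σ i) := by rw [e, pos_swapList_right]
    have h4 : pos (swapList τ (σ i) x) y = pos τ y := pos_swapList_of_ne _ h₂.ne hxy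
    have h5 : pos τ x = pos τ₂ y := by
      rw [← pos_swapList_left τ (σ i) x, e, pos_swapList_left]
    rw [pos_swapList_right] at hlt
    have := h.2.2 y h₂.1 (by omega)
    have := h₂.2.1
    omega
  have hxy : x = y := by
    refine eq_of_pos_eq (τ := swapList τ (σ i) x)
      (le_antisymm (key h h₂ e) ?_) ?_
    · rw [e]; exact key h₂ h e.symm
    · rwa [pos_swapList_right]
  subst hxy
  rw [← swapList_swapList τ (σ i) x, e, swapList_swapList]

end IsPred

end Positions

end TopKChoice

/-! ### Geometric decay of the weight of lists that rank a given centre element -/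

namespace TopKChoice

open Finset

/-- The ratio of consecutive terms is at most `2 / 3`, which sums to the factor `3`. The slack left
by the factor `2 ^ t` pays for the estimate of unranked centre elements. -/
theorem sum_two_pow_mul_le {W : ℕ → ℝ} (h0 : ∀ t, 0 ≤ W t) (h : ∀ t, W (t + 1) ≤ W t / 3)
    (N : ℕ) : ∑ t ∈ range N, 2 ^ t * W t ≤ 3 * W 0 := by
  have key : ∀ N, ∑ t ∈ range N, 2 ^ t * W t + 3 * (2 ^ N * W N) ≤ 3 * W 0 := by
    intro N
    induction N with
    | zero => simp
    | succ N ih =>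
      rw [sum_range_succ, pow_succ]
      have := mul_le_mul_of_nonneg_left (h N) (by positivity : (0 : ℝ) ≤ 2 ^ N)
      linarith
  have := key N
  have := mul_nonneg (by positivity : (0 : ℝ) ≤ 2 ^ N) (h0 N)
  linarith

theorem sum_le_three_halves {W : ℕ → ℝ} (h0 : ∀ t, 0 ≤ W t) (h : ∀ t, W (t + 1) ≤ W t / 3)
    (N : ℕ) : ∑ t ∈ range N, W t ≤ 3 / 2 * W 0 := by
  have key : ∀ N, ∑ t ∈ range N, W t + 3 / 2 * W N ≤ 3 / 2 * W 0 := by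
    intro N
    induction N with
    | zero => simp
    | succ N ih =>
      rw [sum_range_succ]
      have := h N
      linarith
  have := key N
  have := h0 N
  linarith

theorem sum_biUnion_le_of_nonneg {ι κ : Type*} [DecidableEq κ] (s : Finset ι) (t : ι → Finset κ)
    {g : κ → ℝ} (hg : ∀ y, 0 ≤ g y) :
    ∑ y ∈ s.biUnion t, g y ≤ ∑ x ∈ s, ∑ y ∈ t x, g y := by
  classical
  induction s using Finset.induction_on with
  | empty => simp
  | insert a s ha ih =>
    rw [biUnion_insert, sum_insert ha]
    have h1 := sum_union_inter (s₁ := t a) (s₂ := s.biUnion t) (f := g)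
    have h2 : 0 ≤ ∑ y ∈ t a ∩ s.biUnion t, g y := sum_nonneg fun y _ => hg y
    linarith

theorem sum_le_of_injOn {ι κ : Type*} {S : Finset ι} {S' : Finset κ} {f : ι → κ}
    {u : ι → ℝ} {g : κ → ℝ} (hf : ∀ x ∈ S, f x ∈ S') (hinj : Set.InjOn f S)
    (hu : ∀ x ∈ S, u x ≤ g (f x)) (hg : ∀ y ∈ S', 0 ≤ g y) :
    ∑ x ∈ S, u x ≤ ∑ y ∈ S', g y := by
  classical
  calc ∑ x ∈ S, u x ≤ ∑ x ∈ S, g (f x) := sum_le_sum hu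
    _ = ∑ y ∈ S.image f, g y := (sum_image hinj).symm
    _ ≤ ∑ y ∈ S', g y := by
      refine sum_le_sum_of_subset_of_nonneg ?_ fun y hy _ => hg y hy
      intro y hy
      obtain ⟨x, hx, rfl⟩ := mem_image.1 hy
      exact hf x hx

namespace TopKGMM

variable {n k : ℕ} (M : TopKGMM n k)

/-- The unnormalized probability of `τ` as a real number. -/
noncomputable def wt (τ : TopList k n) : ℝ := Real.exp (-M.β * M.dist τ)

theorem wt_pos (τ : TopList k n) : 0 < M.wt τ := Real.exp_pos _

theorem log_three_le (hw : 0 < M.wMin) (hβ : Real.log 3 / M.wMin ≤ M.β) (i : Fin k) :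
    Real.log 3 ≤ M.β * M.w i := by
  have h1 : M.wMin ≤ M.w i := ciInf_le (Set.finite_range _).bddBelow i
  rw [div_le_iff₀ hw] at hβ
  exact hβ.trans (mul_le_mul_of_nonneg_left h1 M.β_nonneg)

/-- If the components of `τ'` are at most those of `τ`, and smaller by `Δ` for the `i`-th centre
element, then `τ` is less likely than `τ'` by a factor `3 ^ Δ`. -/
theorem wt_le_of_components {τ τ' : TopList k n} {i : Fin k} {Δ : ℝ} (hΔ : 0 ≤ Δ)
    (hi3 : Real.log 3 ≤ M.β * M.w i)
    (hQ : invQ M.center τ' ≤ invQ M.center τ)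
    (hd : ∀ d, d ≠ i → invI M.center τ' d ≤ invI M.center τ d ∧
      invP M.center τ' d ≤ invP M.center τ d)
    (hi : (invI M.center τ' i : ℝ) + M.p * invP M.center τ' i + Δ ≤
      invI M.center τ i + M.p * invP M.center τ i) :
    M.wt τ ≤ M.wt τ' * (1 / 3 : ℝ) ^ Δ := by
  have h1 : M.dist τ' + M.w i * Δ ≤ M.dist τ := by
    unfold dist
    have hq : M.w₀ * M.p * (invQ M.center τ' : ℝ) ≤ M.w₀ * M.p * (invQ M.center τ : ℝ) :=
      mul_le_mul_of_nonneg_left (by exact_mod_cast hQ) (mul_nonneg M.w₀_nonneg M.p_pos.le)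
    have hs : ∑ d, M.w d * ((invI M.center τ' d : ℝ) + M.p * (invP M.center τ' d : ℝ)) +
        M.w i * Δ ≤ ∑ d, M.w d * ((invI M.center τ d : ℝ) + M.p * (invP M.center τ d : ℝ)) := by
      rw [← add_sum_erase _ _ (mem_univ i), ← add_sum_erase univ (fun d => M.w d *
        ((invI M.center τ d : ℝ) + M.p * (invP M.center τ d : ℝ))) (mem_univ i)]
      have h2 := mul_le_mul_of_nonneg_left hi (M.w_nonneg i)
      have h3 : ∑ d ∈ univ.erase i,
          M.w d * ((invI M.center τ' d : ℝ) + M.p * (invP M.center τ' d : ℝ)) ≤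
          ∑ d ∈ univ.erase i,
          M.w d * ((invI M.center τ d : ℝ) + M.p * (invP M.center τ d : ℝ)) := by
        refine sum_le_sum fun d hdi => mul_le_mul_of_nonneg_left ?_ (M.w_nonneg d)
        obtain ⟨h4, h5⟩ := hd d (ne_of_mem_erase hdi)
        refine add_le_add (by exact_mod_cast h4)
          (mul_le_mul_of_nonneg_left (by exact_mod_cast h5) M.p_pos.le)
      linarith
    linarith
  have h3 : (1 / 3 : ℝ) ^ Δ = Real.exp (-(Real.log 3 * Δ)) := by
    rw [Real.rpow_def_of_pos (by norm_num), one_div, Real.log_inv, neg_mul]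
  rw [h3, wt, wt, ← Real.exp_add, Real.exp_le_exp]
  have h4 := mul_le_mul_of_nonneg_left h1 M.β_nonneg
  have h5 := mul_le_mul_of_nonneg_right hi3 hΔ
  nlinarith

/-- The weight of the lists that rank the `i`-th centre element below exactly `t` options which
are below it in the centre. -/
noncomputable def rankedWt (i : Fin k) (t : ℕ) : ℝ :=
  ∑ τ : TopList k n with pos τ (M.center i) < k ∧ invI M.center τ i = t, M.wt τ

theorem rankedWt_nonneg (i : Fin k) (t : ℕ) : 0 ≤ M.rankedWt i t :=
  sum_nonneg fun τ _ => (M.wt_pos τ).le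

/-- The exchange with the predecessor maps level `t + 1` injectively to level `t`. Both options are
ranked, so the set of ranked options, and with it `Q` and every `P_d`, is unchanged, while the drop
of `I_i` by one gains a factor of at least `3`. -/
theorem rankedWt_succ_le {i : Fin k} (hi3 : Real.log 3 ≤ M.β * M.w i) (t : ℕ) :
    M.rankedWt i (t + 1) ≤ M.rankedWt i t / 3 := by
  classical
  have hex : ∀ τ : TopList k n, ∃ x, 0 < invI M.center τ i → IsPred M.center τ i x := by
    intro τ
    by_cases h : 0 < invI M.center τ i
    · obtain ⟨x, hx⟩ := exists_isPred h
      exact ⟨x, fun _ => hx⟩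
    -- An arbitrary value: `X` is used only on lists with a positive `invI`.
    · exact ⟨none, fun h' => absurd h' h⟩
  choose X hX using hex
  unfold rankedWt
  rw [sum_div]
  refine sum_le_of_injOn (f := fun τ => swapList τ (M.center i) (X τ)) ?_ ?_ ?_
    (fun τ _ => by have := M.wt_pos τ; positivity)
  · intro τ hτ
    simp only [mem_filter, mem_univ, true_and] at hτ ⊢
    have h := hX τ (by omega)
    have := h.invI_swap
    exact ⟨(h.ranked_swap hτ.1 _).2 hτ.1, by omega⟩
  · intro τ hτ τ₂ hτ₂ e
    simp only [coe_filter, mem_univ, true_and, Set.mem_ofPred_eq] at hτ hτ₂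
    exact (hX τ (by omega)).eq_of_swap_eq hτ.1 (hX τ₂ (by omega)) e
  · intro τ hτ
    simp only [mem_filter, mem_univ, true_and] at hτ
    have h := hX τ (by omega)
    have h1 := M.wt_le_of_components (τ' := swapList τ (M.center i) (X τ)) zero_le_one hi3
      (invQ_le fun x _ hx => (h.ranked_swap hτ.1 x).2 hx)
      (fun d hd => ⟨h.invI_swap_le d hd, (h.invP_swap hτ.1 d).le⟩)
      (by
        rw [h.invP_swap hτ.1, ← h.invI_swap]
        push_cast
        linarith)
    rw [Real.rpow_one] at h1
    linarith

theorem invI_lt (σ τ : TopList k n) (i : Fin k) : invI σ τ i < n + 2 := by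
  rw [invI_eq]
  refine Nat.lt_succ_of_le ((card_le_univ _).trans ?_)
  simp

theorem sum_ranked_eq (i : Fin k) (g : ℕ → ℝ) :
    ∑ τ : TopList k n with pos τ (M.center i) < k, g (invI M.center τ i) * M.wt τ =
      ∑ t ∈ range (n + 2), g t * M.rankedWt i t := by
  classical
  rw [← sum_fiberwise_of_maps_to (g := fun τ => invI M.center τ i) (t := range (n + 2))
    (fun τ _ => mem_range.2 (invI_lt _ _ _))]
  refine sum_congr rfl fun t _ => ?_
  rw [rankedWt, mul_sum, filter_filter]
  refine sum_congr rfl fun τ hτ => ?_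
  rw [(mem_filter.1 hτ).2.2]

theorem sum_ranked_le {i : Fin k} (hi3 : Real.log 3 ≤ M.β * M.w i) :
    ∑ τ : TopList k n with pos τ (M.center i) < k, M.wt τ ≤ 3 / 2 * M.rankedWt i 0 := by
  have h := M.sum_ranked_eq i fun _ => 1
  simp only [one_mul] at h
  rw [h]
  exact sum_le_three_halves (M.rankedWt_nonneg i) (M.rankedWt_succ_le hi3) _

theorem rankedWt_le_total (i : Fin k) (t : ℕ) : M.rankedWt i t ≤ ∑ τ, M.wt τ :=
  sum_le_sum_of_subset_of_nonneg (filter_subset _ _) fun τ _ _ => (M.wt_pos τ).le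

theorem sum_two_pow_invI_le {i : Fin k} (hi3 : Real.log 3 ≤ M.β * M.w i) :
    ∑ τ : TopList k n with pos τ (M.center i) < k, 2 ^ invI M.center τ i * M.wt τ ≤
      3 * ∑ τ, M.wt τ := by
  rw [M.sum_ranked_eq i fun t => 2 ^ t]
  refine (sum_two_pow_mul_le (M.rankedWt_nonneg i) (M.rankedWt_succ_le hi3) _).trans ?_
  have := M.rankedWt_le_total i 0
  linarith

end TopKGMM

/-! ### Lists that leave a centre element unranked are rare -/

/-- `x` is the highest ranked option of `τ` outside the centre `σ`. -/
def IsFirstOutside {n k : ℕ} (σ τ : TopList k n) (x : Item n) : Prop :=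
  pos σ x = k ∧ pos τ x < k ∧ ∀ z, pos σ z = k → pos τ x ≤ pos τ z

/-- The `j`-th centre element is the last one that is unranked in `τ`. -/
def IsLastUnranked {n k : ℕ} (σ τ : TopList k n) (j : Fin k) : Prop :=
  pos τ (σ j) = k ∧ ∀ d, j < d → pos τ (σ d) < k

section Counting

variable {n k : ℕ} {σ τ : TopList k n} {j : Fin k}

/-- Pigeonhole: a list of `k` options that avoids everything outside the centre would contain all
`k` centre elements, including the unranked `σ j`. -/
theorem exists_isFirstOutside (h : pos τ (σ j) = k) : ∃ x, IsFirstOutside σ τ x := by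
  classical
  have hne : ({z | pos σ z = k} : Finset (Item n)).Nonempty := by
    by_contra hemp
    rw [not_nonempty_iff_eq_empty, filter_eq_empty_iff] at hemp
    have hsurj : ∀ x, ∃ l, σ l = x := fun x =>
      ranked_iff.2 (lt_of_le_of_ne (pos_le σ x) (hemp (mem_univ x)))
    have hb : Function.Bijective σ := ⟨σ.injective, hsurj⟩
    have hc := Fintype.card_of_bijective hb
    have hb' : Function.Bijective τ := (Fintype.bijective_iff_injective_and_card τ).2
      ⟨τ.injective, hc⟩
    have := ranked_iff.1 (hb'.2 (σ j))
    omega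
  obtain ⟨x, hx, hmin⟩ := exists_min_image _ (pos τ) hne
  simp only [mem_filter, mem_univ, true_and] at hx hmin
  refine ⟨x, hx, ?_, hmin⟩
  by_contra hk
  have hk' : ∀ l, ∃ l', σ l' = τ l := by
    intro l
    refine ranked_iff.2 (lt_of_le_of_ne (pos_le _ _) fun he => ?_)
    have h1 := hmin _ he
    rw [pos_apply] at h1
    have := l.2
    omega
  choose f hf using hk'
  have hfi : Function.Injective f := fun a b e => τ.injective (by rw [← hf, ← hf, e])
  obtain ⟨l, hl⟩ := (Finite.injective_iff_surjective.1 hfi) j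
  have := hf l
  rw [hl] at this
  rw [this, pos_apply] at h
  have := l.2
  omega

theorem card_center_below (σ : TopList k n) (j : Fin k) :
    #((Ioi j).map σ) = k - 1 - j := by
  rw [card_map, Fin.card_Ioi]

theorem card_below (σ : TopList k n) (j : Fin k) :
    #{x : Item n | j.1 < pos σ x} = n - j := by
  classical
  have h1 : ({x : Item n | ¬ j.1 < pos σ x} : Finset _) = (Iic j).map σ := by
    ext x
    simp only [mem_filter, mem_univ, true_and, mem_map, mem_Iic, not_lt]
    constructor
    · intro h
      obtain ⟨l, rfl⟩ := ranked_iff.2 (h.trans_lt j.2)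
      rw [pos_apply] at h
      exact ⟨l, h, rfl⟩
    · rintro ⟨l, hl, rfl⟩
      rw [pos_apply]; exact hl
  have h2 := card_filter_add_card_filter_not (s := (univ : Finset (Item n)))
    (fun x => j.1 < pos σ x)
  rw [h1, card_map, Fin.card_Iic, card_univ, Fintype.card_option, Fintype.card_fin] at h2
  omega

theorem card_outside (σ : TopList k n) : #{x : Item n | pos σ x = k} = n + 1 - k := by
  classical
  have h1 : ({x : Item n | ¬ pos σ x = k} : Finset _) = univ.map σ := by
    ext x
    simp only [mem_filter, mem_univ, true_and, mem_map]
    constructor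
    · intro h
      exact ranked_iff.2 (lt_of_le_of_ne (pos_le _ _) h)
    · rintro ⟨l, rfl⟩
      rw [pos_apply]; exact l.2.ne
  have h2 := card_filter_add_card_filter_not (s := (univ : Finset (Item n)))
    (fun x => pos σ x = k)
  rw [h1, card_map, card_univ, card_univ, Fintype.card_option, Fintype.card_fin,
    Fintype.card_fin] at h2
  omega

theorem invI_add_invP (h : pos τ (σ j) = k) : invI σ τ j + invP σ τ j = n - j := by
  classical
  rw [invI_eq, invP_eq, ← card_below σ j, h, ← card_filter_add_card_filter_not
    (s := ({x : Item n | j.1 < pos σ x} : Finset _)) (fun x => pos τ x < k), filter_filter,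
    filter_filter]
  simp

variable {y : Item n}

/-- The later centre elements are all ranked, hence above the unranked `σ j`, and so is `y`:
together `(k - 1 - j) + 1` inversions. -/
theorem IsLastUnranked.le_invI (h : IsLastUnranked σ τ j) (hy : IsFirstOutside σ τ y) :
    k - j ≤ invI σ τ j := by
  classical
  have h1 : y ∉ (Ioi j).map σ := by
    intro hm
    obtain ⟨l, -, rfl⟩ := mem_map.1 hm
    have := hy.1
    rw [pos_apply] at this
    have := l.2
    omega
  have h2 : #(insert y ((Ioi j).map σ)) ≤ invI σ τ j := by
    rw [invI_eq]
    refine card_le_card fun x hx => ?_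
    simp only [mem_filter, mem_univ, true_and]
    rw [h.1]
    rcases mem_insert.1 hx with rfl | hx
    · exact ⟨by rw [hy.1]; exact j.2, hy.2.1⟩
    · obtain ⟨l, hl, rfl⟩ := mem_map.1 hx
      rw [mem_Ioi] at hl
      exact ⟨by rw [pos_apply]; exact hl, h.2 l hl⟩
  rw [card_insert_of_notMem h1, card_center_below] at h2
  have := j.2
  omega

theorem IsFirstOutside.ne (hy : IsFirstOutside σ τ y) (d : Fin k) : σ d ≠ y := by
  rintro rfl
  have := hy.1
  rw [pos_apply] at this
  have := d.2
  omega

/-- Having taken the place of the first outside option, `σ j` has no outside option above it, so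
only later centre elements can be counted. -/
theorem IsLastUnranked.invI_swap_le (h : IsLastUnranked σ τ j) (hy : IsFirstOutside σ τ y) :
    invI σ (swapList τ (σ j) y) j ≤ k - 1 - j := by
  rw [← card_center_below σ j, invI_eq]
  refine card_le_card fun x => ?_
  simp only [mem_filter, mem_univ, true_and, pos_swapList_left]
  rintro ⟨h1, h2⟩
  have hxj : x ≠ σ j := by rintro rfl; simp [pos_apply] at h1
  have hxy : x ≠ y := by
    rintro rfl
    rw [pos_swapList_right, h.1] at h2
    exact absurd (h2.trans hy.2.1) (lt_irrefl _)
  rw [pos_swapList_of_ne _ hxj hxy] at h2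
  have h3 : pos σ x < k := lt_of_le_of_ne (pos_le _ _) fun he => by
    have := hy.2.2 x he
    omega
  obtain ⟨l, rfl⟩ := ranked_iff.2 h3
  rw [pos_apply] at h1
  exact mem_map.2 ⟨l, mem_Ioi.2 h1, rfl⟩

theorem IsLastUnranked.swap_components_le (h : IsLastUnranked σ τ j)
    (hy : IsFirstOutside σ τ y) (d : Fin k) (hd : d ≠ j) :
    invI σ (swapList τ (σ j) y) d ≤ invI σ τ d ∧
      invP σ (swapList τ (σ j) y) d ≤ invP σ τ d := by
  rcases lt_or_gt_of_ne hd with hlt | hgt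
  · have h1 : d.1 < pos σ (σ j) := by rw [pos_apply]; exact hlt
    have h2 : d.1 < pos σ y := by rw [hy.1]; exact d.2
    exact ⟨(invI_swapList τ h1 h2).le, (invP_swapList τ h1 h2).le⟩
  · have h1 := h.2 d hgt
    have h2 : pos (swapList τ (σ j) y) (σ d) = pos τ (σ d) :=
      pos_swapList_of_ne _ (fun e => hd (σ.injective e)) (hy.ne d)
    refine ⟨?_, ?_⟩
    · rw [invI_eq, invI_eq, h2]
      refine card_le_card fun x => ?_
      simp only [mem_filter, mem_univ, true_and]
      rintro ⟨h3, h4⟩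
      refine ⟨h3, ?_⟩
      have hxj : x ≠ σ j := by
        rintro rfl
        rw [pos_apply] at h3
        exact absurd hgt (not_lt.2 (le_of_lt (Fin.lt_def.2 h3)))
      have hxy : x ≠ y := by
        rintro rfl
        rw [pos_swapList_right, h.1] at h4
        omega
      rwa [pos_swapList_of_ne _ hxj hxy] at h4
    · rw [invP_of_ranked (by rw [h2]; exact h1)]
      exact Nat.zero_le _

theorem IsLastUnranked.invQ_swap_le (h : IsLastUnranked σ τ j) (hy : IsFirstOutside σ τ y) :
    invQ σ (swapList τ (σ j) y) ≤ invQ σ τ := by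
  refine invQ_le fun x h1 h2 => ?_
  rw [pos_swapList_of_ne]
  · exact h2
  · rintro rfl
    have := h.1
    omega
  · rintro rfl
    have := hy.1
    omega

end Counting

namespace TopKGMM

variable {n k : ℕ} (M : TopKGMM n k)

/-- The factor by which an unranked centre element makes a list less likely. -/
noncomputable def unrankedFactor (n k : ℕ) (p : ℝ) : ℝ :=
  (2 / 3 : ℝ) ^ (min 1 p * ((n + 1 - k : ℕ) : ℝ))

/-- Before the exchange the two components of `j` add up to `n - j`. Afterwards `P_j` is zero and
`I_j` at most `k - 1 - j`. So the drop in `I_j` plus the old `P_j` is at least `n + 1 - k`, and `min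
1 p` accounts for the weight `p` of the second part. -/
theorem wt_le_of_isLastUnranked (hk : k ≤ n) {τ : TopList k n} {j : Fin k} {y : Item n}
    (hi3 : Real.log 3 ≤ M.β * M.w j) (h : IsLastUnranked M.center τ j)
    (hy : IsFirstOutside M.center τ y) :
    M.wt τ ≤ (1 / 2) ^ (k - j : ℕ) * unrankedFactor n k M.p *
      (2 ^ invI M.center (swapList τ (M.center j) y) j *
        M.wt (swapList τ (M.center j) y)) := by
  set τ' := swapList τ (M.center j) y with hτ'
  have hv := h.le_invI hy
  have ht : invI M.center τ' j ≤ k - 1 - j := h.invI_swap_le hy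
  have hsum := invI_add_invP h.1
  have hj := j.2
  set v := invI M.center τ j
  set t := invI M.center τ' j
  set P := invP M.center τ j
  have hP' : invP M.center τ' j = 0 := invP_of_ranked (by
    rw [hτ', pos_swapList_left]; exact hy.2.1)
  have htv : t ≤ v := by omega
  have hΔ0 : 0 ≤ ((v - t : ℕ) : ℝ) + M.p * P :=
    add_nonneg (Nat.cast_nonneg _) (mul_nonneg M.p_pos.le (Nat.cast_nonneg _))
  have h1 := M.wt_le_of_components hΔ0 hi3 (h.invQ_swap_le hy)
    (h.swap_components_le hy) (by
      rw [← hτ', hP']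
      push_cast [Nat.cast_sub htv]
      linarith)
  rw [← hτ'] at h1
  have h2 : (1 / 3 : ℝ) ^ (((v - t : ℕ) : ℝ) + M.p * P) ≤
      (1 / 2) ^ (k - j : ℕ) * unrankedFactor n k M.p * 2 ^ t := by
    -- The gain is split in two. The power of `1 / 2` makes the later sum over `j` converge
    -- independently of `k`, at the price of `2 ^ t`; the power of `2 / 3` gives the decay in `n -
    -- k`.
    have e : (1 / 3 : ℝ) = 1 / 2 * (2 / 3) := by norm_num
    rw [e, Real.mul_rpow (by norm_num) (by norm_num)]
    have h3 : (1 / 2 : ℝ) ^ (((v - t : ℕ) : ℝ) + M.p * P) ≤ (1 / 2) ^ (k - j : ℕ) * 2 ^ t := by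
      calc (1 / 2 : ℝ) ^ (((v - t : ℕ) : ℝ) + M.p * P) ≤ (1 / 2 : ℝ) ^ ((v - t : ℕ) : ℝ) := by
            refine Real.rpow_le_rpow_of_exponent_ge (by norm_num) (by norm_num) ?_
            have := mul_nonneg M.p_pos.le (Nat.cast_nonneg (α := ℝ) P)
            linarith
        _ = (1 / 2 : ℝ) ^ v * 2 ^ t := by
            rw [Real.rpow_natCast]
            have : (1 / 2 : ℝ) ^ v = (1 / 2) ^ (v - t) * (1 / 2) ^ t := by
              rw [← pow_add]; congr 1; omega
            rw [this, mul_assoc, ← mul_pow]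
            norm_num
        _ ≤ _ := by
            refine mul_le_mul_of_nonneg_right ?_ (by positivity)
            exact pow_le_pow_of_le_one (by norm_num) (by norm_num) hv
    have h4 : (2 / 3 : ℝ) ^ (((v - t : ℕ) : ℝ) + M.p * P) ≤ unrankedFactor n k M.p := by
      refine Real.rpow_le_rpow_of_exponent_ge (by norm_num) (by norm_num) ?_
      have h5 : ((n + 1 - k : ℕ) : ℝ) ≤ ((v - t : ℕ) : ℝ) + P := by
        exact_mod_cast (by omega : n + 1 - k ≤ v - t + P)
      have hq0 : 0 ≤ min 1 M.p := le_min zero_le_one M.p_pos.le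
      calc min 1 M.p * ((n + 1 - k : ℕ) : ℝ) ≤ min 1 M.p * (((v - t : ℕ) : ℝ) + P) :=
            mul_le_mul_of_nonneg_left h5 hq0
        _ = min 1 M.p * ((v - t : ℕ) : ℝ) + min 1 M.p * P := mul_add _ _ _
        _ ≤ 1 * ((v - t : ℕ) : ℝ) + M.p * P := by
            gcongr
            · exact min_le_left _ _
            · exact min_le_right _ _
        _ = _ := by rw [one_mul]
    calc _ ≤ ((1 / 2) ^ (k - j : ℕ) * 2 ^ t) * unrankedFactor n k M.p :=
          mul_le_mul h3 h4 (by positivity) (by positivity)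
      _ = _ := by ring
  calc M.wt τ ≤ M.wt τ' * ((1 / 2) ^ (k - j : ℕ) * unrankedFactor n k M.p * 2 ^ t) :=
        h1.trans (mul_le_mul_of_nonneg_left h2 (M.wt_pos _).le)
    _ = _ := by ring

-- The exchange need not be injective as a whole, but it is an involution for a fixed outside option
-- `y`. The lists are therefore grouped by `y`, which costs the factor `n + 1 - k`, and
-- `sum_two_pow_invI_le` absorbs the powers of two.
open Classical in
theorem sum_isLastUnranked_le (hk : k ≤ n) {j : Fin k} (hi3 : Real.log 3 ≤ M.β * M.w j) :
    ∑ τ : TopList k n with IsLastUnranked M.center τ j, M.wt τ ≤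
      (1 / 2) ^ (k - j : ℕ) *
        ((n + 1 - k : ℕ) * (3 * unrankedFactor n k M.p) * ∑ τ, M.wt τ) := by
  have hex : ∀ τ : TopList k n, ∃ y, IsLastUnranked M.center τ j →
      IsFirstOutside M.center τ y := by
    intro τ
    by_cases h : IsLastUnranked M.center τ j
    · obtain ⟨y, hy⟩ := exists_isFirstOutside h.1
      exact ⟨y, fun _ => hy⟩
    · exact ⟨none, fun h' => absurd h' h⟩
  choose Y hY using hex
  have hF : 0 ≤ unrankedFactor n k M.p := Real.rpow_nonneg (by norm_num) _
  rw [← sum_fiberwise_of_maps_to (g := Y) (t := ({x : Item n | pos M.center x = k} : Finset _))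
    (fun τ hτ => by
      simp only [mem_filter, mem_univ, true_and] at hτ ⊢
      exact (hY τ hτ).1)]
  have hfib : ∀ y ∈ ({x : Item n | pos M.center x = k} : Finset _),
      ∑ τ ∈ ({τ : TopList k n | IsLastUnranked M.center τ j} : Finset _) with Y τ = y, M.wt τ ≤
        (1 / 2) ^ (k - j : ℕ) * unrankedFactor n k M.p * (3 * ∑ τ, M.wt τ) := by
    intro y _
    refine le_trans ?_ (mul_le_mul_of_nonneg_left (M.sum_two_pow_invI_le hi3)
      (by positivity))
    rw [mul_sum]
    refine sum_le_of_injOn (f := fun τ => swapList τ (M.center j) y) ?_ ?_ ?_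
      (fun τ _ => by have := M.wt_pos τ; positivity)
    · intro τ hτ
      simp only [mem_filter, mem_univ, true_and] at hτ ⊢
      have h := hY τ hτ.1
      rw [hτ.2] at h
      rw [pos_swapList_left]
      exact h.2.1
    · intro τ _ τ₂ _ e
      have e' : swapList τ (M.center j) y = swapList τ₂ (M.center j) y := e
      rw [← swapList_swapList τ (M.center j) y, e', swapList_swapList]
    · intro τ hτ
      simp only [mem_filter, mem_univ, true_and] at hτ
      have h := hY τ hτ.1
      rw [hτ.2] at h
      exact M.wt_le_of_isLastUnranked hk hi3 hτ.1 h
  refine (sum_le_sum hfib).trans ?_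
  rw [sum_const, card_outside, nsmul_eq_mul]
  exact le_of_eq (by ring)

theorem sum_half_pow_le (k : ℕ) : ∑ j : Fin k, (1 / 2 : ℝ) ^ (k - j : ℕ) ≤ 1 := by
  rw [Fin.sum_univ_eq_sum_range (fun j => (1 / 2 : ℝ) ^ (k - j : ℕ))]
  have key : ∀ k, ∑ j ∈ range k, (1 / 2 : ℝ) ^ (k - j : ℕ) + (1 / 2) ^ k ≤ 1 := by
    intro k
    induction k with
    | zero => simp
    | succ k ih =>
      rw [sum_range_succ', Nat.sub_zero]
      simp only [Nat.add_sub_add_right]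
      have : (1 / 2 : ℝ) ^ (k + 1) + (1 / 2) ^ (k + 1) = (1 / 2) ^ k := by ring
      linarith
  have := key k
  have : (0 : ℝ) ≤ (1 / 2) ^ k := by positivity
  linarith

-- Every such list has a last unranked centre element `j`, possibly different from `i`. The union
-- bound over `j` costs nothing because of the factors `(1 / 2) ^ (k - j)`.
open Classical in
theorem sum_unranked_le (hk : k ≤ n) (hi3 : ∀ j, Real.log 3 ≤ M.β * M.w j) (i : Fin k) :
    ∑ τ : TopList k n with ¬ pos τ (M.center i) < k, M.wt τ ≤
      (n + 1 - k : ℕ) * (3 * unrankedFactor n k M.p) * ∑ τ, M.wt τ := by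
  have hF : 0 ≤ unrankedFactor n k M.p := Real.rpow_nonneg (by norm_num) _
  have hZ : 0 ≤ ∑ τ, M.wt τ := sum_nonneg fun τ _ => (M.wt_pos τ).le
  have hsub : ({τ : TopList k n | ¬ pos τ (M.center i) < k} : Finset _) ⊆
      univ.biUnion fun j => {τ : TopList k n | IsLastUnranked M.center τ j} := by
    intro τ hτ
    simp only [mem_filter, mem_univ, true_and, mem_biUnion] at hτ ⊢
    have hne : ({j | ¬ pos τ (M.center j) < k} : Finset (Fin k)).Nonempty := ⟨i, by simpa using hτ⟩
    obtain ⟨j, hj, hmax⟩ := exists_max_image _ id hne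
    simp only [mem_filter, mem_univ, true_and, id] at hj hmax
    refine ⟨j, le_antisymm (pos_le _ _) (not_lt.1 hj), fun d hd => ?_⟩
    by_contra hd'
    exact absurd (hmax d hd') (not_le.2 hd)
  calc _ ≤ ∑ τ ∈ univ.biUnion fun j => {τ : TopList k n | IsLastUnranked M.center τ j}, M.wt τ :=
        sum_le_sum_of_subset_of_nonneg hsub fun τ _ _ => (M.wt_pos τ).le
    _ ≤ ∑ j, ∑ τ : TopList k n with IsLastUnranked M.center τ j, M.wt τ := by
        exact sum_biUnion_le_of_nonneg _ _ fun τ => (M.wt_pos τ).le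
    _ ≤ ∑ j : Fin k, (1 / 2) ^ (k - j : ℕ) *
        ((n + 1 - k : ℕ) * (3 * unrankedFactor n k M.p) * ∑ τ, M.wt τ) :=
        sum_le_sum fun j _ => M.sum_isLastUnranked_le hk (hi3 j)
    _ ≤ _ := by
        rw [← sum_mul]
        exact mul_le_of_le_one_left (by positivity) (sum_half_pow_le k)

/-- At least `0.99` of the weight ranks the element, and level `0` has two thirds of that: `0.66`.
-/
theorem rankedWt_zero_ge (hk : k ≤ n) (hi3 : ∀ j, Real.log 3 ≤ M.β * M.w j)
    (hs : (n + 1 - k : ℕ) * (3 * unrankedFactor n k M.p) ≤ 1 / 100) (i : Fin k) :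
    0.66 * ∑ τ, M.wt τ ≤ M.rankedWt i 0 := by
  classical
  have h1 := M.sum_ranked_le (hi3 i)
  have h2 := M.sum_unranked_le hk hi3 i
  have h3 := sum_filter_add_sum_filter_not univ (fun τ : TopList k n => pos τ (M.center i) < k)
    M.wt
  have hZ : 0 ≤ ∑ τ, M.wt τ := sum_nonneg fun τ _ => (M.wt_pos τ).le
  have h4 := mul_le_mul_of_nonneg_right hs hZ
  linarith

end TopKGMM

end TopKChoice

namespace TopKChoice

open Finset

/-! ### Choice probabilities of a single customer -/

section Oracle

variable {k n : ℕ}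

theorem IsTop.unique {τ : TopList k n} {S : Finset (Item n)} {x y : Item n}
    (hx : IsTop τ S x) (hy : IsTop τ S y) : x = y := by
  by_contra hne
  have h1 := above_iff.1 (hx.2 y hy.1 (Ne.symm hne))
  have h2 := above_iff.1 (hy.2 x hx.1 hne)
  omega

theorem choose_of_isTop {τ : TopList k n} {A : Finset (Fin n)} {x : Item n}
    (h : IsTop τ (withNull A) x) : choose τ A = PMF.pure x := by
  have hex : ∃ x, IsTop τ (withNull A) x := ⟨x, h⟩
  rw [choose, dif_pos hex, hex.choose_spec.unique h]

theorem choose_of_not_exists {τ : TopList k n} {A : Finset (Fin n)}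
    (h : ¬ ∃ x, IsTop τ (withNull A) x) :
    choose τ A = PMF.uniformOfFinset (withNull A) (withNull_nonempty A) := dif_neg h

theorem isTop_swapList {τ : TopList k n} {S : Finset (Item n)} {a b : Item n}
    (ha : a ∈ S) (hb : b ∈ S) {x : Item n} (h : IsTop τ S x) :
    IsTop (swapList τ a b) S (Equiv.swap a b x) := by
  have hS : ∀ z ∈ S, Equiv.swap a b z ∈ S := by
    intro z hz
    by_cases h1 : z = a
    · rwa [h1, Equiv.swap_apply_left]
    by_cases h2 : z = b
    · rwa [h2, Equiv.swap_apply_right]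
    rwa [Equiv.swap_apply_of_ne_of_ne h1 h2]
  refine ⟨hS x h.1, fun y hy hne => ?_⟩
  rw [above_iff, pos_swapList, pos_swapList, Equiv.swap_apply_self]
  refine above_iff.1 (h.2 _ (hS y hy) fun e => hne ?_)
  rw [← e, Equiv.swap_apply_self]

theorem choose_swapList {τ : TopList k n} {A : Finset (Fin n)} {a b : Item n}
    (ha : a ∈ withNull A) (hb : b ∈ withNull A) :
    choose (swapList τ a b) A a = choose τ A b := by
  by_cases h : ∃ x, IsTop τ (withNull A) x
  · obtain ⟨x, hx⟩ := h
    rw [choose_of_isTop hx, choose_of_isTop (isTop_swapList ha hb hx), PMF.pure_apply,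
      PMF.pure_apply]
    have : a = Equiv.swap a b x ↔ b = x := by
      rw [eq_comm, Equiv.swap_apply_eq_iff, Equiv.swap_apply_left, eq_comm]
    simp only [this]
    congr
  · have h' : ¬ ∃ x, IsTop (swapList τ a b) (withNull A) x := by
      rintro ⟨x, hx⟩
      have := isTop_swapList ha hb hx
      rw [swapList_swapList] at this
      exact h ⟨_, this⟩
    rw [choose_of_not_exists h, choose_of_not_exists h', PMF.uniformOfFinset_apply_of_mem _ ha,
      PMF.uniformOfFinset_apply_of_mem _ hb]

namespace TopKGMM

variable (M : TopKGMM n k)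

theorem weight_eq (τ : TopList k n) : M.weight τ = ENNReal.ofReal (M.wt τ) := rfl

theorem tsum_weight : ∑' τ, M.weight τ = ENNReal.ofReal (∑ τ, M.wt τ) := by
  rw [tsum_fintype, ENNReal.ofReal_sum_of_nonneg fun τ _ => (M.wt_pos τ).le]
  rfl

/-- Outside options lie below every centre element, so `I` and `P` are only relabelled. For `Q`, one
inequality suffices because the exchange is an involution. -/
theorem dist_swapList {a b : Item n} (ha : pos M.center a = k) (hb : pos M.center b = k)
    (τ : TopList k n) : M.dist (swapList τ a b) = M.dist τ := by
  have hQ : invQ M.center (swapList τ a b) = invQ M.center τ := by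
    have key : ∀ τ : TopList k n, invQ M.center (swapList τ a b) ≤ invQ M.center τ := by
      intro τ
      refine invQ_le fun x h1 h2 => ?_
      rwa [pos_swapList_of_ne]
      · rintro rfl; omega
      · rintro rfl; omega
    refine le_antisymm (key τ) ?_
    have := key (swapList τ a b)
    rwa [swapList_swapList] at this
  unfold dist
  rw [hQ]
  congr 1
  refine sum_congr rfl fun d _ => ?_
  have h1 : d.1 < pos M.center a := by rw [ha]; exact d.2
  have h2 : d.1 < pos M.center b := by rw [hb]; exact d.2
  rw [invI_swapList τ h1 h2, invP_swapList τ h1 h2]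

/-- Exchanging `a` and `b` in the customer's list preserves the law and interchanges the two
choices, including the uniform tie-breaking. -/
theorem oracle_eq_of_outside {A : Finset (Fin n)} {a b : Item n} (ha : a ∈ withNull A)
    (hb : b ∈ withNull A) (ha' : pos M.center a = k) (hb' : pos M.center b = k) :
    M.oracle A a = M.oracle A b := by
  rw [oracle, PMF.bind_apply, PMF.bind_apply, tsum_fintype, tsum_fintype]
  refine Fintype.sum_equiv (Function.Involutive.toPerm (fun τ => swapList τ a b)
    fun τ => swapList_swapList τ a b) _ _ fun τ => ?_
  have h1 : M.law (swapList τ a b) = M.law τ := by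
    rw [law, PMF.normalize_apply, PMF.normalize_apply, weight, weight,
      M.dist_swapList ha' hb']
  change M.law τ * choose τ A a = M.law (swapList τ a b) * choose (swapList τ a b) A b
  rw [h1]
  congr 1
  have := choose_swapList (τ := swapList τ a b) ha hb
  rwa [swapList_swapList] at this

theorem le_oracle_of_isTop {A : Finset (Fin n)} {i : Fin k} {x : Item n} {q : ℝ} (hq : 0 ≤ q)
    (hZ : q * ∑ τ, M.wt τ ≤ M.rankedWt i 0) (hx : M.center i = x)
    (hA : x ∈ withNull A) (hbelow : ∀ y ∈ withNull A, y ≠ x → i.1 < pos M.center y) :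
    ENNReal.ofReal q ≤ M.oracle A x := by
  classical
  have htop : ∀ τ : TopList k n, pos τ (M.center i) < k → invI M.center τ i = 0 →
      choose τ A x = 1 := by
    intro τ h1 h2
    have : IsTop τ (withNull A) x := by
      refine ⟨hA, fun y hy hne => above_iff.2 ?_⟩
      rw [invI_eq, card_eq_zero, filter_eq_empty_iff] at h2
      have h3 := h2 (mem_univ y)
      have h4 := hbelow y hy hne
      subst hx
      refine lt_of_le_of_ne (not_lt.1 fun h => h3 ⟨h4, h⟩) fun e => hne ?_
      exact (eq_of_pos_eq e h1).symm
    rw [choose_of_isTop this, PMF.pure_apply_self]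
  have hZ0 : ENNReal.ofReal (∑ τ, M.wt τ) ≠ 0 := M.tsum_weight ▸ M.tsum_weight_ne_zero
  rw [oracle, PMF.bind_apply, tsum_fintype]
  calc ENNReal.ofReal q
      = ENNReal.ofReal (q * ∑ τ, M.wt τ) * (ENNReal.ofReal (∑ τ, M.wt τ))⁻¹ := by
        rw [ENNReal.ofReal_mul hq, mul_assoc, ENNReal.mul_inv_cancel hZ0 ENNReal.ofReal_ne_top,
          mul_one]
    _ ≤ ENNReal.ofReal (M.rankedWt i 0) * (ENNReal.ofReal (∑ τ, M.wt τ))⁻¹ := by gcongr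
    _ = ∑ τ : TopList k n with pos τ (M.center i) < k ∧ invI M.center τ i = 0,
          M.law τ * choose τ A x := by
        rw [rankedWt, ENNReal.ofReal_sum_of_nonneg fun τ _ => (M.wt_pos τ).le, sum_mul]
        refine sum_congr rfl fun τ hτ => ?_
        simp only [mem_filter, mem_univ, true_and] at hτ
        rw [htop τ hτ.1 hτ.2, mul_one, law, PMF.normalize_apply, M.tsum_weight, weight_eq]
    _ ≤ _ := sum_le_sum_of_subset (filter_subset _ _)

end TopKGMM

end Oracle

/-! ### Failure probabilities that add up along adaptive sampling -/

section FailProb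

variable {α β : Type*}

/-- The property `G` fails with probability at most `δ` under `d`. -/
def FailLE (d : PMF α) (δ : ENNReal) (G : α → Prop) : Prop :=
  d.toOuterMeasure {x | ¬ G x} ≤ δ

theorem FailLE.mono {d : PMF α} {δ δ' : ENNReal} {G G' : α → Prop} (h : FailLE d δ G)
    (hδ : δ ≤ δ') (hG : ∀ x, G x → G' x) : FailLE d δ' G' :=
  by
  refine le_trans (MeasureTheory.measure_mono ?_) (le_trans h hδ)
  exact fun x hx h' => hx (hG x h')

theorem failLE_pure {x : α} {G : α → Prop} (h : G x) : FailLE (PMF.pure x) 0 G := by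
  classical
  unfold FailLE
  rw [PMF.toOuterMeasure_pure_apply, if_neg]
  simpa using h

theorem FailLE.and {d : PMF α} {δ δ' : ENNReal} {G G' : α → Prop} (h : FailLE d δ G)
    (h' : FailLE d δ' G') : FailLE d (δ + δ') fun x => G x ∧ G' x := by
  refine le_trans ?_ (add_le_add h h')
  refine le_trans (MeasureTheory.measure_mono ?_) (MeasureTheory.measure_union_le _ _)
  intro x hx
  by_cases hG : G x
  · exact Or.inr fun hG' => hx ⟨hG, hG'⟩
  · exact Or.inl hG

theorem failLE_forall_finset {ι : Type*} {d : PMF α} {δ : ENNReal} {G : ι → α → Prop}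
    (s : Finset ι) (h : ∀ i ∈ s, FailLE d δ (G i)) :
    FailLE d (s.card * δ) fun x => ∀ i ∈ s, G i x := by
  classical
  induction s using Finset.induction_on with
  | empty =>
    unfold FailLE
    simp
  | insert a s ha ih =>
    have h1 := (h a (mem_insert_self _ _)).and (ih fun i hi => h i (mem_insert_of_mem hi))
    refine h1.mono ?_ fun x hx i hi => ?_
    · rw [card_insert_of_notMem ha]
      push_cast
      rw [add_mul, one_mul, add_comm]
    · rcases mem_insert.1 hi with rfl | hi
      · exact hx.1
      · exact hx.2 i hi

theorem toOuterMeasure_le_one (d : PMF α) (s : Set α) : d.toOuterMeasure s ≤ 1 := by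
  rw [PMF.toOuterMeasure_apply, ← d.tsum_coe]
  exact ENNReal.tsum_le_tsum fun x => Set.indicator_le_self _ _ x

/-- This is the union bound in adaptive form: a bad outcome of `d` is charged at most its own
probability, a good one at most `δ'`. The later queries may depend on earlier answers. -/
theorem FailLE.bind {d : PMF α} {f : α → PMF β} {δ δ' : ENNReal} {G : α → Prop} {H : β → Prop}
    (h : FailLE d δ G) (hf : ∀ x, G x → FailLE (f x) δ' H) :
    FailLE (d.bind f) (δ + δ') H := by
  classical
  unfold FailLE
  rw [PMF.toOuterMeasure_bind_apply]
  calc ∑' a, d a * (f a).toOuterMeasure {x | ¬ H x}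
      ≤ ∑' a, (({x | ¬ G x} : Set α).indicator d a + d a * δ') := by
        refine ENNReal.tsum_le_tsum fun a => ?_
        by_cases ha : G a
        · exact le_add_left (mul_le_mul_right (hf a ha) _)
        · rw [Set.indicator_of_mem (by exact ha)]
          exact le_add_right (mul_le_of_le_one_right zero_le (toOuterMeasure_le_one _ _))
    _ ≤ δ + δ' := by
        rw [ENNReal.tsum_add, ENNReal.tsum_mul_right, d.tsum_coe, one_mul,
          ← PMF.toOuterMeasure_apply]
        exact add_le_add_left h _

theorem FailLE.le_toOuterMeasure {d : PMF α} {δ : ℝ} (hδ : 0 ≤ δ) {G : α → Prop}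
    (h : FailLE d (ENNReal.ofReal δ) G) :
    ENNReal.ofReal (1 - δ) ≤ d.toOuterMeasure {x | G x} := by
  have h1 : 1 ≤ d.toOuterMeasure {x | G x} + d.toOuterMeasure {x | ¬ G x} := by
    refine le_trans (le_of_eq ?_) (MeasureTheory.measure_union_le _ _)
    symm
    rw [PMF.toOuterMeasure_apply_eq_one_iff]
    intro x _
    exact em (G x)
  rw [ENNReal.ofReal_sub _ hδ, ENNReal.ofReal_one]
  exact tsub_le_iff_right.2 (h1.trans (add_le_add_right h _))

end FailProb

/-! ### Exponential moments of independent samples -/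

section Samples

variable {α : Type}

theorem failLE_samples_length (d : PMF α) (m : ℕ) :
    FailLE (samples d m) 0 fun S => S.length = m := by
  induction m with
  | zero => exact failLE_pure rfl
  | succ m ih =>
    have h0 : FailLE d 0 fun _ => True := by
      unfold FailLE
      simp
    have : (0 : ENNReal) = 0 + (0 + 0) := by simp
    rw [this]
    refine h0.bind fun x _ => ih.bind fun xs hxs => failLE_pure ?_
    simp [hxs]

theorem tsum_samples_prod (d : PMF α) (f : α → ENNReal) (m : ℕ) :
    ∑' S, samples d m S * (S.map f).prod = (∑' x, d x * f x) ^ m := by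
  have hbind : ∀ {γ δ : Type} (p : PMF γ) (q : γ → PMF δ) (g : δ → ENNReal),
      ∑' y, p.bind q y * g y = ∑' x, p x * ∑' y, q x y * g y := by
    intro γ δ p q g
    simp only [PMF.bind_apply, ← ENNReal.tsum_mul_right, ← ENNReal.tsum_mul_left]
    rw [ENNReal.tsum_comm]
    simp only [mul_assoc]
  have hpure : ∀ {γ : Type} (y : γ) (g : γ → ENNReal), ∑' x, PMF.pure y x * g x = g y := by
    intro γ y g
    refine (tsum_eq_single y fun x hx => ?_).trans ?_
    · rw [PMF.pure_apply_of_ne _ _ hx, zero_mul]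
    · rw [PMF.pure_apply_self, one_mul]
  induction m with
  | zero => rw [samples, hpure]; simp
  | succ m ih =>
    rw [samples, hbind]
    simp only [hbind, hpure, List.map_cons, List.prod_cons]
    rw [pow_succ', ← ENNReal.tsum_mul_right]
    refine tsum_congr fun x => ?_
    rw [← ih, ← ENNReal.tsum_mul_left, ← ENNReal.tsum_mul_left]
    refine tsum_congr fun S => ?_
    ring

theorem prod_map_ofReal_exp (g : α → ℝ) (S : List α) :
    (S.map fun x => ENNReal.ofReal (Real.exp (g x))).prod =
      ENNReal.ofReal (Real.exp (S.map g).sum) := by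
  induction S with
  | nil => simp
  | cons x S ih =>
    rw [List.map_cons, List.prod_cons, ih, List.map_cons, List.sum_cons, Real.exp_add,
      ENNReal.ofReal_mul (Real.exp_nonneg _)]

/-- The exponential Markov inequality for independent samples. -/
theorem failLE_samples_sum_neg [Fintype α] (d : PMF α) (g : α → ℝ) {θ : ℝ}
    (hθ : ∑ x, (d x).toReal * Real.exp (g x) ≤ θ) (m : ℕ) :
    FailLE (samples d m) (ENNReal.ofReal (θ ^ m)) fun S => (S.map g).sum < 0 := by
  classical
  unfold FailLE
  rw [PMF.toOuterMeasure_apply]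
  have h0 : 0 ≤ θ := le_trans (sum_nonneg fun x _ => by positivity) hθ
  calc ∑' S, ({S | ¬ (S.map g).sum < 0} : Set (List α)).indicator (samples d m) S
      ≤ ∑' S, samples d m S * (S.map fun x => ENNReal.ofReal (Real.exp (g x))).prod := by
        refine ENNReal.tsum_le_tsum fun S => ?_
        by_cases hS : (S.map g).sum < 0
        · rw [Set.indicator_of_notMem (by simpa using hS)]
          exact zero_le
        · rw [Set.indicator_of_mem (by exact hS), prod_map_ofReal_exp]
          refine le_mul_of_one_le_right zero_le ?_
          rw [← ENNReal.ofReal_one]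
          exact ENNReal.ofReal_le_ofReal (Real.one_le_exp (not_lt.1 hS))
    _ = (∑ x, d x * ENNReal.ofReal (Real.exp (g x))) ^ m := by
        rw [tsum_samples_prod, tsum_fintype]
    _ ≤ ENNReal.ofReal (θ ^ m) := by
        rw [ENNReal.ofReal_pow h0]
        gcongr
        refine le_trans (le_of_eq ?_) (ENNReal.ofReal_le_ofReal hθ)
        rw [ENNReal.ofReal_sum_of_nonneg fun x _ => by positivity]
        refine sum_congr rfl fun x _ => ?_
        rw [ENNReal.ofReal_mul ENNReal.toReal_nonneg, ENNReal.ofReal_toReal (d.apply_ne_top x)]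

theorem sum_toReal_eq_one [Fintype α] (d : PMF α) : ∑ x, (d x).toReal = 1 := by
  rw [← ENNReal.toReal_sum fun x _ => d.apply_ne_top x, ← tsum_fintype (L := .unconditional _), d.tsum_coe,
    ENNReal.toReal_one]

end Samples

end TopKChoice

namespace TopKChoice

open Finset

/-! ### Concentration for the `FindTop` test -/

section FindTop

variable {n : ℕ}

theorem pairScore_cons (x : Item n) (S : List (Item n)) (a b : Item n) :
    pairScore (x :: S) a b = (if x = a then (1 : ℤ) else if x = b then -1 else 0) +
      pairScore S a b := by
  simp [pairScore]

theorem pairScore_symm (S : List (Item n)) {a b : Item n} (h : a ≠ b) :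
    pairScore S a b = - pairScore S b a := by
  induction S with
  | nil => simp [pairScore]
  | cons x S ih =>
    rw [pairScore_cons, pairScore_cons, ih]
    by_cases h1 : x = a
    · have h2 : x ≠ b := fun e => h (h1.symm.trans e)
      simp [h1, h]; ring
    · by_cases h2 : x = b
      · simp [h2, h.symm]; ring
      · simp [h1, h2]

/-- The score is antisymmetric in its two options, so both margins cannot be positive. Hence the
choice made inside `findTop` is immaterial. -/
theorem Beats.unique {A : Finset (Fin n)} {S : List (Item n)} {a b : Item n}
    (ha : Beats A S a) (hb : Beats A S b) : a = b := by
  by_contra hne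
  have h1 := ha.2 b hb.1 (Ne.symm hne)
  have h2 := hb.2 a ha.1 hne
  rw [pairScore_symm S hne] at h1
  push_cast at h1
  rw [neg_div] at h1
  have : (0 : ℝ) < 1 / (2 * (1 + (A.card : ℝ))) := by positivity
  linarith

theorem Beats.findTop_eq {A : Finset (Fin n)} {S : List (Item n)} {a : Item n}
    (ha : Beats A S a) : findTop A S = some a := by
  have hex : ∃ a, Beats A S a := ⟨a, ha⟩
  rw [findTop, dif_pos hex, hex.choose_spec.unique ha]

theorem beats_of_findTop_eq {A : Finset (Fin n)} {S : List (Item n)} {a : Item n}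
    (h : findTop A S = some a) : Beats A S a := by
  unfold findTop at h
  split_ifs at h with hex
  have := hex.choose_spec
  rwa [Option.some.inj h] at this

/-- The worst case is that every sample different from `c` equals `b`. -/
theorem two_mul_count_sub_length_le (S : List (Item n)) (c b : Item n) :
    2 * (S.count c : ℤ) - S.length ≤ pairScore S c b := by
  induction S with
  | nil => simp [pairScore]
  | cons x S ih =>
    rw [pairScore_cons, List.count_cons, List.length_cons]
    push_cast
    by_cases h1 : x = c
    · simp [h1]; linarith
    · by_cases h2 : x = b
      · have h3 : b ≠ c := fun e => h1 (h2.trans e)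
        simp [h2, h3]; linarith
      · simp [h1, h2]; linarith

theorem sum_map_ite (S : List (Item n)) (c : Item n) (u v : ℝ) :
    (S.map fun x => if x = c then u else v).sum = u * S.count c + v * (S.length - S.count c) := by
  induction S with
  | nil => simp
  | cons x S ih =>
    rw [List.map_cons, List.sum_cons, ih, List.count_cons, List.length_cons]
    by_cases h : x = c
    · simp [h]; ring
    · simp [h]; ring

theorem sum_map_score (S : List (Item n)) (a b : Item n) (u v : ℝ) :
    (S.map fun x => u * ((if x = a then (1 : ℝ) else if x = b then -1 else 0) - v)).sum =
      u * (pairScore S a b - v * S.length) := by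
  induction S with
  | nil => simp [pairScore]
  | cons x S ih =>
    rw [List.map_cons, List.sum_cons, ih, pairScore_cons, List.length_cons]
    push_cast
    ring

theorem failLE_beats {d : PMF (Item n)} {c : Item n} (hc : 0.66 ≤ (d c).toReal)
    {A : Finset (Fin n)} (hcA : c ∈ withNull A) (hA : 0 < A.card) (m : ℕ) :
    FailLE (samples d m) (ENNReal.ofReal (0.998 ^ m)) fun S => Beats A S c := by
  classical
  set L := Real.log 1.01 with hL
  have hL0 : 0 < L := Real.log_pos (by norm_num)
  have hexp : ∀ j : ℕ, Real.exp (j * L) = 1.01 ^ j := by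
    intro j
    rw [Real.exp_nat_mul, hL, Real.exp_log (by norm_num)]
  -- The scores `-3` and `5` test whether the frequency of `c` exceeds `5 / 8`, which lies below
  -- `0.66` and forces a margin above `1 / 4`. The step `log 1.01` is small enough that `0.66 * 1.01
  -- ^ (-3) + 0.34 * 1.01 ^ 5 ≤ 0.998`.
  have h1 : ∑ x, (d x).toReal * Real.exp (if x = c then -(3 : ℕ) * L else (5 : ℕ) * L) ≤
      0.998 := by
    have h2 := sum_toReal_eq_one d
    rw [← add_sum_erase _ _ (mem_univ c)] at h2 ⊢
    have h3 : ∑ x ∈ univ.erase c,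
        (d x).toReal * Real.exp (if x = c then -(3 : ℕ) * L else (5 : ℕ) * L) =
        (∑ x ∈ univ.erase c, (d x).toReal) * 1.01 ^ 5 := by
      rw [sum_mul]
      refine sum_congr rfl fun x hx => ?_
      rw [if_neg (ne_of_mem_erase hx), hexp]
    rw [h3, if_pos rfl, neg_mul, Real.exp_neg, hexp]
    have h4 : ∑ x ∈ univ.erase c, (d x).toReal = 1 - (d c).toReal := by linarith
    rw [h4]
    norm_num at hc ⊢
    linarith
  refine (failLE_samples_sum_neg d _ h1 m).mono le_rfl fun S hS => ⟨hcA, fun b _ _ => ?_⟩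
  rw [sum_map_ite] at hS
  push_cast at hS
  have h5 : L * (5 * S.length - 8 * S.count c) < 0 := by linarith
  have h6 : (5 : ℝ) * S.length < 8 * S.count c := by
    by_contra! h
    exact absurd h5 (not_lt.2 (mul_nonneg hL0.le (by linarith)))
  have h7 : (2 * (S.count c : ℝ) - S.length) ≤ pairScore S c b := by
    exact_mod_cast two_mul_count_sub_length_le S c b
  have h8 : (S.count c : ℝ) ≤ S.length := by exact_mod_cast List.count_le_length
  have h9 : (0 : ℝ) < S.length := by
    by_contra! h
    have : (0 : ℝ) ≤ S.count c := Nat.cast_nonneg _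
    linarith
  have h10 : 1 / (2 * (1 + (A.card : ℝ))) ≤ 1 / 4 := by
    have : (1 : ℝ) ≤ A.card := by exact_mod_cast hA
    exact one_div_le_one_div_of_le (by norm_num) (by linarith)
  refine h10.trans_lt ?_
  rw [lt_div_iff₀ h9]
  linarith

/-- A score difference with equal probabilities has mean zero and values in `{-1, 0, 1}`, so its
exponential moment is at most `cosh t`. With the threshold `t` itself as exponent parameter, `cosh t
≤ exp (t ^ 2 / 2)` leaves `exp (-t ^ 2 / 2)` per sample. -/
theorem failLE_not_beats {d : PMF (Item n)} {a b : Item n} (hab : a ≠ b) (h : d a = d b)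
    {A : Finset (Fin n)} (hb : b ∈ withNull A) (m : ℕ) :
    FailLE (samples d m) (ENNReal.ofReal (Real.exp (-(1 / (8 * (1 + (A.card : ℝ)) ^ 2))) ^ m))
      fun S => ¬ Beats A S a := by
  classical
  set t : ℝ := 1 / (2 * (1 + (A.card : ℝ))) with ht
  have ht0 : 0 < t := by positivity
  have h1 : ∑ x, (d x).toReal *
      Real.exp (t * ((if x = a then (1 : ℝ) else if x = b then -1 else 0) - t)) ≤
      Real.exp (-(1 / (8 * (1 + (A.card : ℝ)) ^ 2))) := by
    have h2 := sum_toReal_eq_one d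
    have hb' : b ∈ univ.erase a := mem_erase.2 ⟨hab.symm, mem_univ _⟩
    rw [← add_sum_erase _ _ (mem_univ a), ← add_sum_erase _ _ hb', ← h] at h2
    rw [← add_sum_erase _ _ (mem_univ a), ← add_sum_erase _ _ hb', ← h]
    have h3 : ∑ x ∈ (univ.erase a).erase b, (d x).toReal *
        Real.exp (t * ((if x = a then (1 : ℝ) else if x = b then -1 else 0) - t)) =
        (∑ x ∈ (univ.erase a).erase b, (d x).toReal) * Real.exp (-(t * t)) := by
      rw [sum_mul]
      refine sum_congr rfl fun x hx => ?_
      rw [if_neg (ne_of_mem_erase (mem_of_mem_erase hx)), if_neg (ne_of_mem_erase hx)]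
      congr 2
      ring
    have h4 : 0 ≤ ∑ x ∈ (univ.erase a).erase b, (d x).toReal :=
      sum_nonneg fun x _ => ENNReal.toReal_nonneg
    rw [h3, if_pos rfl, if_neg hab.symm, if_pos rfl]
    set q := (d a).toReal
    have h5 : ∑ x ∈ (univ.erase a).erase b, (d x).toReal = 1 - 2 * q := by linarith
    rw [h5] at h4 ⊢
    have e1 : Real.exp (t * (1 - t)) = Real.exp t * Real.exp (-(t * t)) := by
      rw [← Real.exp_add]; congr 1; ring
    have e2 : Real.exp (t * (-1 - t)) = Real.exp (-t) * Real.exp (-(t * t)) := by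
      rw [← Real.exp_add]; congr 1; ring
    have hcosh := Real.cosh_le_exp_half_sq t
    have hone := Real.one_le_cosh t
    rw [e1, e2]
    calc q * (Real.exp t * Real.exp (-(t * t))) + (q * (Real.exp (-t) * Real.exp (-(t * t))) +
          (1 - 2 * q) * Real.exp (-(t * t)))
        = (2 * q * Real.cosh t + (1 - 2 * q) * 1) * Real.exp (-(t * t)) := by
          rw [Real.cosh_eq]; ring
      _ ≤ (2 * q * Real.cosh t + (1 - 2 * q) * Real.cosh t) * Real.exp (-(t * t)) := by gcongr
      _ = Real.cosh t * Real.exp (-(t * t)) := by ring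
      _ ≤ Real.exp (t ^ 2 / 2) * Real.exp (-(t * t)) := by gcongr
      _ = _ := by
          rw [← Real.exp_add]
          congr 1
          rw [ht]
          field_simp
          ring
  refine (failLE_samples_sum_neg d _ h1 m).mono le_rfl fun S hS hbeats => ?_
  rw [sum_map_score] at hS
  have h6 := hbeats.2 b hb hab.symm
  rw [← ht] at h6
  have h9 : (0 : ℝ) < S.length := by
    rcases (Nat.cast_nonneg (α := ℝ) S.length).lt_or_eq with h | h
    · exact h
    · rw [← h, div_zero] at h6
      exact absurd h6 (not_lt.2 ht0.le)
  rw [lt_div_iff₀ h9] at h6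
  exact absurd hS (not_lt.2 (mul_nonneg ht0.le (by linarith)))

end FindTop

/-! ### The error probability of one query -/

section Query

variable {n k : ℕ}

/-- `a` is the highest centre element of the assortment `A`. -/
def HighestIn (σ : TopList k n) (A : Finset (Fin n)) (a : Fin n) : Prop :=
  a ∈ A ∧ pos σ (some a) < k ∧ ∀ b ∈ A, pos σ (some a) ≤ pos σ (some b)

/-- The answer of `findTop` that is correct for the assortment `A` and the centre `σ`. -/
def CorrectAnswer (σ : TopList k n) (A : Finset (Fin n)) (o : Option (Item n)) : Prop :=
  (∀ a, HighestIn σ A a → o = some (some a)) ∧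
    ((∀ a ∈ A, pos σ (some a) = k) → ∀ a, o ≠ some (some a))

theorem HighestIn.unique {σ : TopList k n} {A : Finset (Fin n)} {a b : Fin n}
    (ha : HighestIn σ A a) (hb : HighestIn σ A b) : a = b :=
  Option.some.inj (eq_of_pos_eq (le_antisymm (ha.2.2 b hb.1) (hb.2.2 a ha.1)) ha.2.1)

theorem exists_highestIn {σ : TopList k n} {A : Finset (Fin n)} {a : Fin n} (ha : a ∈ A)
    (hak : pos σ (some a) < k) : ∃ a, HighestIn σ A a := by
  obtain ⟨x, hx, hmin⟩ := exists_min_image A (fun a => pos σ (some a)) ⟨a, ha⟩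
  exact ⟨x, hx, (hmin a ha).trans_lt hak, hmin⟩

/-- A bound for the probability that a single query is answered wrongly. -/
noncomputable def queryError (n : ℕ) : ENNReal := ENNReal.ofReal (1 / (n : ℝ) ^ 8)

theorem exp_neg_mul_log (n : ℕ) (hn : 2 ≤ n) (j : ℕ) :
    Real.exp (-(j * Real.log n)) = 1 / (n : ℝ) ^ j := by
  have h0 : (0 : ℝ) < n := by exact_mod_cast (by omega : 0 < n)
  rw [Real.exp_neg, Real.exp_nat_mul, Real.exp_log h0, one_div]

theorem TopKGMM.failLE_query (M : TopKGMM n k) (hn : 2 ≤ n) {r m : ℕ} (hr : 2 ≤ r)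
    (hm : 1000 * ((r : ℝ) ^ 2 * Real.log n) ≤ m) (hc : ∀ l, M.center l ≠ none)
    (hZ : ∀ i, 0.66 * ∑ τ, M.wt τ ≤ M.rankedWt i 0) {A : Finset (Fin n)} (hA : A.card ≤ r) :
    FailLE (samples (M.oracle A) m) (queryError n)
      fun S => S.length = m ∧ CorrectAnswer M.center A (findTop A S) := by
  classical
  have hn' : (2 : ℝ) ≤ n := by exact_mod_cast hn
  have hr' : (2 : ℝ) ≤ r := by exact_mod_cast hr
  have hlog : 0 ≤ Real.log n := Real.log_nonneg (by linarith)
  suffices h : FailLE (samples (M.oracle A) m) (queryError n)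
      fun S => CorrectAnswer M.center A (findTop A S) by
    have := (failLE_samples_length (M.oracle A) m).and h
    rwa [zero_add] at this
  have hnone : pos M.center none = k := pos_of_not_ranked fun ⟨l, hl⟩ => hc l hl
  by_cases hex : ∃ a ∈ A, pos M.center (some a) < k
  · obtain ⟨a₀, ha₀, hak₀⟩ := hex
    obtain ⟨a, ha⟩ := exists_highestIn ha₀ hak₀
    obtain ⟨i, hi⟩ := ranked_iff.2 ha.2.1
    have hia : pos M.center (some a) = i := by rw [← hi, pos_apply]
    have haA : some a ∈ withNull A := Finset.some_mem_insertNone.2 ha.1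
    have h1 : ENNReal.ofReal 0.66 ≤ M.oracle A (some a) := by
      refine M.le_oracle_of_isTop (by norm_num) (hZ i) hi haA fun y hy hne => ?_
      rw [← hia]
      cases y with
      | none => rw [hnone]; exact ha.2.1
      | some b =>
        refine lt_of_le_of_ne (ha.2.2 b (Finset.some_mem_insertNone.1 hy)) fun e => hne ?_
        exact (eq_of_pos_eq e ha.2.1).symm
    have h2 : (0.66 : ℝ) ≤ (M.oracle A (some a)).toReal :=
      (ENNReal.ofReal_le_iff_le_toReal (PMF.apply_ne_top _ _)).1 h1
    refine (failLE_beats h2 haA (card_pos.2 ⟨a, ha.1⟩) m).mono ?_ fun S hS =>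
      ⟨fun b hb => ?_, fun hall => ?_⟩
    · refine ENNReal.ofReal_le_ofReal ?_
      have h3 : (0.998 : ℝ) ≤ Real.exp (-0.002) := by
        have := Real.add_one_le_exp (-0.002 : ℝ)
        linarith
      calc (0.998 : ℝ) ^ m ≤ Real.exp (-0.002) ^ m := by gcongr
        _ = Real.exp (m * -0.002) := (Real.exp_nat_mul _ _).symm
        _ ≤ Real.exp (-((8 : ℕ) * Real.log n)) := by
            refine Real.exp_le_exp.2 ?_
            push_cast
            -- Only `r ≥ 2` is used here: `0.002 * 1000 * 4 = 8` gives the required exponent.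
            have : 4 * Real.log n ≤ (r : ℝ) ^ 2 * Real.log n :=
              mul_le_mul_of_nonneg_right (by nlinarith) hlog
            linarith
        _ = _ := exp_neg_mul_log n hn 8
    · rw [hb.unique ha]
      exact hS.findTop_eq
    · exact absurd (hall a ha.1) ha.2.1.ne
  · push Not at hex
    have hout : ∀ a ∈ A, pos M.center (some a) = k := fun a ha =>
      le_antisymm (pos_le _ _) (hex a ha)
    -- The exponent is `9` rather than `8` because the union over at most `n` products of `A` loses
    -- a factor `n`. It suffices to compare each product with `none`.
    have h1 : ∀ a ∈ A, FailLE (samples (M.oracle A) m) (ENNReal.ofReal (1 / (n : ℝ) ^ 9))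
        fun S => ¬ Beats A S (some a) := by
      intro a ha
      have haA : some a ∈ withNull A := Finset.some_mem_insertNone.2 ha
      have hnA : none ∈ withNull A := Finset.none_mem_insertNone
      refine (failLE_not_beats (Option.some_ne_none a)
        (M.oracle_eq_of_outside haA hnA (hout a ha) hnone) hnA m).mono ?_ fun _ h => h
      refine ENNReal.ofReal_le_ofReal ?_
      rw [← Real.exp_nat_mul, ← exp_neg_mul_log n hn 9]
      refine Real.exp_le_exp.2 ?_
      rw [mul_neg, neg_le_neg_iff, mul_one_div, le_div_iff₀ (by positivity)]
      have h2 : (A.card : ℝ) ≤ r := by exact_mod_cast hA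
      have h3 : 8 * (1 + (A.card : ℝ)) ^ 2 ≤ 18 * (r : ℝ) ^ 2 := by
        have : (1 + (A.card : ℝ)) ^ 2 ≤ (3 / 2 * r) ^ 2 :=
          pow_le_pow_left₀ (by positivity) (by linarith) 2
        nlinarith
      push_cast
      calc 9 * Real.log n * (8 * (1 + (A.card : ℝ)) ^ 2)
          ≤ 9 * Real.log n * (18 * (r : ℝ) ^ 2) := by gcongr
        _ = 162 * ((r : ℝ) ^ 2 * Real.log n) := by ring
        _ ≤ m := by
            have : 0 ≤ (r : ℝ) ^ 2 * Real.log n := by positivity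
            linarith
    refine (failLE_forall_finset A h1).mono ?_ fun S hS => ⟨fun a ha => ?_, fun _ a ha => ?_⟩
    · have h2 : (A.card : ENNReal) ≤ ENNReal.ofReal n := by
        rw [ENNReal.ofReal_natCast]
        exact_mod_cast (card_le_univ A).trans (by simp)
      refine (mul_le_mul_left h2 _).trans ?_
      rw [← ENNReal.ofReal_mul (by linarith)]
      refine ENNReal.ofReal_le_ofReal (le_of_eq ?_)
      field_simp
    · exact absurd (hout a ha.1) ha.2.1.ne
    · have hb := beats_of_findTop_eq ha
      exact hS a (Finset.some_mem_insertNone.1 hb.1) hb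

end Query

end TopKChoice

namespace TopKChoice

open Finset

/-! ### Correctness of the algorithm when all queries are answered correctly -/

section Algorithm

variable {n k : ℕ} {σ : TopList k n} {O : Finset (Fin n) → PMF (Item n)} {sel : Selector n}
  {r m : ℕ} {δ : ENNReal}

/-- Every query of `D` shows an assortment of at most `r` products to `m` customers. -/
def DataOK (r m : ℕ) (D : ChoiceData n) : Prop := ∀ q ∈ D, q.1.card ≤ r ∧ q.2.length = m

theorem DataOK.append {D : ChoiceData n} (h : DataOK r m D) {A : Finset (Fin n)}
    {S : List (Item n)} (hA : A.card ≤ r) (hS : S.length = m) :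
    DataOK r m (D ++ [(A, S)]) := by
  intro q hq
  rcases List.mem_append.1 hq with hq | hq
  · exact h q hq
  · rw [List.mem_singleton.1 hq]
    exact ⟨hA, hS⟩

/-- Every query is answered correctly, up to an error probability of `δ`. -/
def OracleOK (σ : TopList k n) (O : Finset (Fin n) → PMF (Item n)) (r m : ℕ) (δ : ENNReal) :
    Prop :=
  ∀ A : Finset (Fin n), A.card ≤ r → FailLE (samples (O A) m) δ
    fun S => S.length = m ∧ CorrectAnswer σ A (findTop A S)

theorem card_assortment_le (sel : Selector n) (r : ℕ) (U B : Finset (Fin n)) :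
    (assortment sel r U B).card ≤ r := by
  refine (card_union_le _ _).trans ?_
  have h1 := sel.card_pick r U
  have h2 := sel.card_pick (r - (sel.pick r U).card) B
  omega

theorem mem_of_mem_assortment {U B : Finset (Fin n)} {a : Fin n}
    (h : a ∈ assortment sel r U B) : a ∈ sel.pick r U ∨ a ∈ B :=
  (mem_union.1 h).imp_right fun h => sel.pick_subset _ _ h

theorem CorrectAnswer.highestIn {A : Finset (Fin n)} {o : Option (Item n)} {a : Fin n}
    (h : CorrectAnswer σ A o) (ho : o = some (some a)) : HighestIn σ A a := by
  by_cases hex : ∃ b ∈ A, pos σ (some b) < k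
  · obtain ⟨b, hb, hbk⟩ := hex
    obtain ⟨c, hc⟩ := exists_highestIn hb hbk
    have := h.1 c hc
    rw [ho] at this
    rw [Option.some.inj (Option.some.inj this)]
    exact hc
  · push Not at hex
    exact absurd ho (h.2 (fun b hb => le_antisymm (pos_le _ _) (hex b hb)) a)

theorem CorrectAnswer.outside {A : Finset (Fin n)} {o : Option (Item n)}
    (h : CorrectAnswer σ A o) (ho : ∀ a, o ≠ some (some a)) {b : Fin n} (hb : b ∈ A) :
    pos σ (some b) = k := by
  by_contra hne
  obtain ⟨c, hc⟩ := exists_highestIn hb (lt_of_le_of_ne (pos_le _ _) hne)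
  exact ho c (h.1 c hc)

/-- The invariant of the main loop. -/
structure BuildInv (σ : TopList k n) (r m : ℕ) (s : BuildState n) : Prop where
  data : DataOK r m s.data
  top : ∀ a ∈ s.T, pos σ (some a) < k
  bottom : ∀ a ∈ s.B, pos σ (some a) = k
  cover : ∀ a, pos σ (some a) < k → a ∈ s.T ∨ a ∈ s.U

/-- Each correct answer removes at least one product from `U`: the returned centre element cannot
come from the filling `B`, and a rejected assortment contains a nonempty part of `U`. So the number
of undecided products bounds the iterations. -/
theorem failLE_buildLoop (hO : OracleOK σ O r m δ) (hr : 2 ≤ r) (fuel : ℕ) (s : BuildState n)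
    (hs : BuildInv σ r m s) (hfuel : s.U.card ≤ fuel) :
    FailLE (buildLoop O sel r m fuel s) (fuel * δ)
      fun s' => BuildInv σ r m s' ∧ s'.U = ∅ := by
  induction fuel generalizing s with
  | zero =>
    refine (failLE_pure ⟨hs, ?_⟩).mono zero_le fun _ h => h
    exact card_eq_zero.1 (Nat.le_zero.1 hfuel)
  | succ fuel ih =>
    rw [buildLoop]
    split_ifs with hU
    · exact (failLE_pure ⟨hs, hU⟩).mono zero_le fun _ h => h
    have hδ : ((fuel + 1 : ℕ) : ENNReal) * δ = δ + fuel * δ := by push_cast; ring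
    rw [hδ]
    refine (hO _ (card_assortment_le sel r s.U s.B)).bind fun S ⟨hlen, hcorrect⟩ => ?_
    set A := assortment sel r s.U s.B with hA
    have hdata := hs.data.append (card_assortment_le sel r s.U s.B) hlen
    have hpick := sel.pick_subset r s.U
    split
    · next a ho =>
      have ha := hcorrect.highestIn ho
      have haU : a ∈ s.U := by
        rcases mem_of_mem_assortment ha.1 with h | h
        · exact hpick h
        · exact absurd (hs.bottom a h) ha.2.1.ne
      refine ih _ ⟨hdata, fun b hb => ?_, hs.bottom, fun b hb => ?_⟩ ?_
      · rcases mem_insert.1 hb with rfl | hb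
        · exact ha.2.1
        · exact hs.top b hb
      · by_cases hba : b = a
        · exact Or.inl (hba ▸ mem_insert_self _ _)
        · exact (hs.cover b hb).imp (fun h => mem_insert_of_mem h)
            fun h => mem_erase.2 ⟨hba, h⟩
      · change (s.U.erase a).card ≤ fuel
        rw [card_erase_of_mem haU]
        omega
    · next hno =>
      have hout : ∀ b ∈ A, pos σ (some b) = k := fun b hb =>
        hcorrect.outside (fun a ha => hno a ha) hb
      refine ih _ ⟨hdata, hs.top, fun b hb => ?_, fun b hb => ?_⟩ ?_
      · rcases mem_union.1 hb with hb | hb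
        · exact hs.bottom b hb
        · exact hout b hb
      · exact (hs.cover b hb).imp_right fun h => mem_sdiff.2 ⟨h, fun h' => hb.ne (hout b h')⟩
      · change (s.U \ A).card ≤ fuel
        have h1 : 0 < (sel.pick r s.U).card := by
          have := card_pos.2 (nonempty_iff_ne_empty.2 hU)
          rw [sel.card_pick]
          omega
        obtain ⟨b, hb⟩ := card_pos.1 h1
        have h2 : (s.U \ A).card < s.U.card :=
          card_lt_card ((ssubset_iff_of_subset sdiff_subset).2
            ⟨b, hpick hb, fun h => (mem_sdiff.1 h).2 (mem_union_left _ hb)⟩)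
        omega

/-- The best candidate `x` wins whichever assortment contains it, since the fillers are outside the
centre. The strict inequality drives the tournament: as `r ≥ 2`, the first assortment of at least
two candidates replaces two or more of them by one. -/
theorem failLE_tourRound (hO : OracleOK σ O r m δ) (hr : 2 ≤ r) {B R : Finset (Fin n)}
    (hB : ∀ a ∈ B, pos σ (some a) = k) {x : Fin n} (hx : HighestIn σ R x) (fuel : ℕ)
    (rest won : Finset (Fin n)) (D : ChoiceData n) (hD : DataOK r m D)
    (hrest : rest ⊆ R) (hwon : won ⊆ R) (hcenter : ∀ a ∈ R, pos σ (some a) < k)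
    (hmem : x ∈ won ∨ x ∈ rest) (hfuel : rest.card ≤ fuel) :
    FailLE (tourRound O sel r m B fuel rest won D) (fuel * δ)
      fun y => DataOK r m y.2 ∧ y.1 ⊆ R ∧ x ∈ y.1 ∧ y.1.card ≤ won.card + rest.card ∧
        (2 ≤ rest.card → y.1.card < won.card + rest.card) := by
  induction fuel generalizing rest won D with
  | zero =>
    have h0 : rest = ∅ := card_eq_zero.1 (Nat.le_zero.1 hfuel)
    subst h0
    refine (failLE_pure ⟨hD, hwon, ?_, ?_, ?_⟩).mono zero_le fun _ h => h
    · exact hmem.resolve_right (notMem_empty _)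
    · exact Nat.le_add_right _ _
    · intro h; simp at h
  | succ fuel ih =>
    rw [tourRound]
    split_ifs with h0
    · subst h0
      refine (failLE_pure ⟨hD, hwon, ?_, ?_, ?_⟩).mono zero_le fun _ h => h
      · exact hmem.resolve_right (notMem_empty _)
      · exact Nat.le_add_right _ _
      · intro h; simp at h
    have hδ : ((fuel + 1 : ℕ) : ENNReal) * δ = δ + fuel * δ := by push_cast; ring
    rw [hδ]
    refine (hO _ (card_assortment_le sel r rest B)).bind fun S ⟨hlen, hcorrect⟩ => ?_
    set A := assortment sel r rest B with hA
    have hdata := hD.append (card_assortment_le sel r rest B) hlen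
    have hpick := sel.pick_subset r rest
    have hcp := sel.card_pick r rest
    have hpos := card_pos.2 (nonempty_iff_ne_empty.2 h0)
    have hsd := card_sdiff_of_subset hpick
    split
    · next a ho =>
      have ha := hcorrect.highestIn ho
      have hap : a ∈ sel.pick r rest := by
        rcases mem_of_mem_assortment ha.1 with h | h
        · exact h
        · exact absurd (hB a h) ha.2.1.ne
      have hci := card_insert_le a won
      refine (ih (rest \ sel.pick r rest) (insert a won) _ hdata (sdiff_subset.trans hrest)
        (insert_subset (hrest (hpick hap)) hwon) ?_ ?_).mono le_rfl ?_
      · rcases hmem with h | h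
        · exact Or.inl (mem_insert_of_mem h)
        · by_cases hxp : x ∈ sel.pick r rest
          · left
            have hxA : HighestIn σ A x := by
              refine ⟨mem_union_left _ hxp, hx.2.1, fun b hb => ?_⟩
              rcases mem_of_mem_assortment hb with h | h
              · exact hx.2.2 b (hrest (hpick h))
              · rw [hB b h]; exact pos_le _ _
            rw [hxA.unique ha]
            exact mem_insert_self _ _
          · exact Or.inr (mem_sdiff.2 ⟨h, hxp⟩)
      · omega
      · rintro y ⟨h1, h2, h3, h4, -⟩
        exact ⟨h1, h2, h3, by omega, by omega⟩
    · next hno =>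
      -- Every assortment of the tournament contains a candidate, hence a centre element, so a
      -- correct answer is a product.
      exfalso
      have hpos' : 0 < (sel.pick r rest).card := by omega
      obtain ⟨b, hb⟩ := card_pos.1 hpos'
      have := hcorrect.outside (fun a ha => hno a ha) (mem_union_left _ hb)
      exact (hcenter b (hrest (hpick hb))).ne this

/-- A round with at least two candidates shrinks the set and a round with one candidate ends the
tournament, so `|T|` rounds suffice. Each costs at most `n` queries. -/
theorem failLE_tournament (hO : OracleOK σ O r m δ) (hr : 2 ≤ r) {B : Finset (Fin n)}
    (hB : ∀ a ∈ B, pos σ (some a) = k) {x : Fin n} (fuel : ℕ)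
    (T : Finset (Fin n)) (hx : HighestIn σ T x) (D : ChoiceData n) (hD : DataOK r m D)
    (hcenter : ∀ a ∈ T, pos σ (some a) < k) (hfuel : T.card ≤ fuel) :
    FailLE (tournament O sel r m B fuel T D) (fuel * (n * δ))
      fun y => DataOK r m y.2 ∧ y.1 = {x} := by
  induction fuel generalizing T D with
  | zero =>
    have h0 : T = ∅ := card_eq_zero.1 (Nat.le_zero.1 hfuel)
    subst h0
    exact absurd hx.1 (notMem_empty _)
  | succ fuel ih =>
    rw [tournament]
    have hδ : ((fuel + 1 : ℕ) : ENNReal) * (n * δ) = n * δ + fuel * (n * δ) := by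
      push_cast; ring
    rw [hδ]
    have hTn : (T.card : ENNReal) ≤ n := by
      exact_mod_cast (card_le_univ T).trans (by simp)
    have hround := failLE_tourRound (sel := sel) hO hr hB hx T.card T ∅ D hD subset_rfl
      (empty_subset _) hcenter (Or.inr hx.1) le_rfl
    refine (hround.mono (mul_le_mul_left hTn δ) fun _ h => h).bind ?_
    rintro y ⟨hyD, hyT, hxy, hcard, hlt⟩
    rw [card_empty, zero_add] at hcard hlt
    split_ifs with h1
    · refine (failLE_pure ⟨hyD, ?_⟩).mono zero_le fun _ h => h
      obtain ⟨z, hz⟩ := card_eq_one.1 h1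
      rw [hz, mem_singleton] at hxy
      rw [hz, hxy]
    · have hypos := card_pos.2 ⟨x, hxy⟩
      exact ih y.1 ⟨hxy, hx.2.1, fun b hb => hx.2.2 b (hyT hb)⟩ y.2 hyD
        (fun a ha => hcenter a (hyT ha)) (by omega)

/-- With `j` elements left to sort, `U` holds exactly the centre elements from position `k - j` on,
so the tournament returns the one at that position. -/
theorem failLE_sortCntr (hO : OracleOK σ O r m δ) (hr : 2 ≤ r) (hσ : ∀ l, σ l ≠ none)
    {B : Finset (Fin n)} (hB : ∀ a ∈ B, pos σ (some a) = k) (j : ℕ) (hj : j ≤ k)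
    (U : Finset (Fin n)) (hU : ∀ a, a ∈ U ↔ k - j ≤ pos σ (some a) ∧ pos σ (some a) < k)
    (acc : List (Fin n)) (hacc : acc.map some = (List.ofFn σ).take (k - j))
    (D : ChoiceData n) (hD : DataOK r m D) :
    FailLE (sortCntr O sel r m B j U acc D) (j * (n * (n * δ)))
      fun y => DataOK r m y.2 ∧ y.1.map some = List.ofFn σ := by
  induction j generalizing U acc D with
  | zero =>
    refine (failLE_pure ⟨hD, ?_⟩).mono zero_le fun _ h => h
    rw [hacc, List.take_of_length_le (by simp)]
  | succ j ih =>
    rw [sortCntr]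
    have hδ : ((j + 1 : ℕ) : ENNReal) * (n * (n * δ)) = n * (n * δ) + j * (n * (n * δ)) := by
      push_cast; ring
    rw [hδ]
    have hlt : k - (j + 1) < k := by omega
    obtain ⟨x, hx⟩ := Option.ne_none_iff_exists'.1 (hσ ⟨k - (j + 1), hlt⟩)
    have hpx : pos σ (some x) = k - (j + 1) := by rw [← hx, pos_apply]
    have hxU : HighestIn σ U x := by
      refine ⟨(hU x).2 (by omega), by omega, fun b hb => ?_⟩
      rw [hpx]
      exact ((hU b).1 hb).1
    have hUn : (U.card : ENNReal) ≤ n := by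
      exact_mod_cast (card_le_univ U).trans (by simp)
    have ht := failLE_tournament (sel := sel) hO hr hB U.card U hxU D hD
      (fun a ha => ((hU a).1 ha).2) le_rfl
    refine (ht.mono (mul_le_mul_left hUn _) fun _ h => h).bind ?_
    rintro y ⟨hyD, hy⟩
    rw [hy]
    refine ih (by omega) _ (fun a => ?_) _ ?_ _ hyD
    · rw [mem_sdiff, hU, mem_singleton]
      constructor
      · rintro ⟨h1, h2⟩
        refine ⟨?_, h1.2⟩
        by_contra h3
        exact h2 (Option.some.inj (eq_of_pos_eq (τ := σ) (by omega) h1.2))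
      · rintro ⟨h1, h2⟩
        refine ⟨by omega, ?_⟩
        rintro rfl
        omega
    · have hkj : k - j = k - (j + 1) + 1 := by omega
      rw [List.map_append, hacc, hkj, toList_singleton, List.take_succ_eq_append_getElem
        (by simpa using hlt), List.getElem_ofFn, hx]
      simp

theorem card_center_products (hσ : ∀ l, σ l ≠ none) {T : Finset (Fin n)}
    (hT : ∀ a, a ∈ T ↔ pos σ (some a) < k) : T.card = k := by
  have h : T.map Function.Embedding.some = univ.map σ := by
    ext x
    simp only [mem_map, mem_univ, true_and, Function.Embedding.some_apply]
    constructor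
    · rintro ⟨a, ha, rfl⟩
      exact ranked_iff.2 ((hT a).1 ha)
    · rintro ⟨l, rfl⟩
      obtain ⟨a, ha⟩ := Option.ne_none_iff_exists'.1 (hσ l)
      refine ⟨a, (hT a).2 ?_, ha.symm⟩
      rw [← ha, pos_apply]
      exact l.2
  have := congrArg card h
  rwa [card_map, card_map, card_univ, Fintype.card_fin] at this

theorem failLE_bucchoi (hO : OracleOK σ O r m δ) (hr : 2 ≤ r) (hσ : ∀ l, σ l ≠ none)
    (hk : k ≤ n) :
    FailLE (bucchoi O sel r m) (n * δ + n * (n * (n * δ)))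
      fun out => out.size = k ∧ out.center.map some = List.ofFn σ ∧
        ∀ q ∈ out.data, q.1.card ≤ r ∧ q.2.length = m := by
  unfold bucchoi
  have hinit : BuildInv σ r m { T := ∅, B := ∅, U := Finset.univ, data := [] } :=
    ⟨fun q hq => absurd hq List.not_mem_nil, fun a ha => absurd ha (notMem_empty _),
      fun a ha => absurd ha (notMem_empty _), fun a _ => Or.inr (mem_univ a)⟩
  refine (failLE_buildLoop (sel := sel) hO hr n _ hinit (by simp)).bind ?_
  rintro s ⟨hs, hU⟩
  have hT : ∀ a, a ∈ s.T ↔ pos σ (some a) < k := fun a =>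
    ⟨hs.top a, fun h => (hs.cover a h).resolve_right (by rw [hU]; exact notMem_empty _)⟩
  have hcard : s.T.card = k := card_center_products hσ hT
  rw [hcard, ← add_zero (_ * _)]
  have hkn : (k : ENNReal) ≤ n := by exact_mod_cast hk
  refine ((failLE_sortCntr (sel := sel) hO hr hσ hs.bottom k le_rfl s.T
    (fun a => by rw [hT]; omega) [] (by simp) s.data hs.data).mono
      (mul_le_mul_left hkn _) fun _ h => h).bind ?_
  rintro y ⟨hyD, hy⟩
  exact failLE_pure ⟨rfl, hy, hyD⟩

end Algorithm

end TopKChoice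

/-! ### Choice of the sample size and of the error function -/

namespace TopKChoice

open Filter in
theorem tendsto_unranked_bound {q : ℝ} (hq : 0 < q) :
    Tendsto (fun s : ℕ => ((s + 1 : ℕ) : ℝ) * (3 * (2 / 3 : ℝ) ^ (q * ((s + 1 : ℕ) : ℝ))))
      atTop (nhds 0) := by
  set a : ℝ := (2 / 3 : ℝ) ^ q with ha
  have ha0 : 0 ≤ a := Real.rpow_nonneg (by norm_num) _
  have ha1 : a < 1 := Real.rpow_lt_one (by norm_num) (by norm_num) hq
  have h := ((tendsto_add_atTop_iff_nat 1).2
    (tendsto_self_mul_const_pow_of_lt_one ha0 ha1)).const_mul 3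
  rw [mul_zero] at h
  refine h.congr fun s => ?_
  rw [Real.rpow_mul (by norm_num), ← ha, Real.rpow_natCast]
  ring

/-- The condition on `s = n - k` under which the centre elements are ranked with high
probability. -/
def IsLargeGap (p : ℝ) (s : ℕ) : Prop :=
  2 ≤ s ∧ ((s + 1 : ℕ) : ℝ) * (3 * (2 / 3 : ℝ) ^ (min 1 p * ((s + 1 : ℕ) : ℝ))) ≤ 1 / 100

open Classical in
/-- The error probability of `bucchoi` in terms of `s = n - k`. -/
noncomputable def algError (p : ℝ) (s : ℕ) : ℝ := if IsLargeGap p s then 1 / (s : ℝ) else 1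

open Filter in
theorem tendsto_algError {p : ℝ} (hp : 0 < p) : Tendsto (algError p) atTop (nhds 0) := by
  refine tendsto_one_div_atTop_nhds_zero_nat.congr' ?_
  have h := (tendsto_unranked_bound (lt_min one_pos hp)).eventually_le_const
    (by norm_num : (0 : ℝ) < 1 / 100)
  filter_upwards [h, eventually_ge_atTop 2] with s h1 h2
  rw [algError, if_pos ⟨h2, h1⟩]

/-- The number of samples per query. -/
noncomputable def sampleSize (n r : ℕ) : ℕ := ⌈1000 * ((r : ℝ) ^ 2 * Real.log n)⌉₊

theorem le_sampleSize (n r : ℕ) : 1000 * ((r : ℝ) ^ 2 * Real.log n) ≤ sampleSize n r :=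
  Nat.le_ceil _

theorem sampleSize_le {n r : ℕ} (hn : 2 ≤ n) (hr : 2 ≤ r) :
    (sampleSize n r : ℝ) ≤ 1001 * ((r : ℝ) ^ 2 * Real.log n) := by
  have hn' : (2 : ℝ) ≤ n := by exact_mod_cast hn
  have hr' : (2 : ℝ) ≤ r := by exact_mod_cast hr
  have h1 : 1 / 2 ≤ Real.log n := by
    have := Real.log_two_gt_d9
    have := Real.log_le_log (by norm_num) hn'
    linarith
  -- This absorbs the rounding of the ceiling, which turns the constant `1000` into `1001`.
  have h2 : 1 ≤ (r : ℝ) ^ 2 * Real.log n := by nlinarith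
  have h3 := (Nat.ceil_lt_add_one (a := 1000 * ((r : ℝ) ^ 2 * Real.log n)) (by linarith)).le
  unfold sampleSize
  linarith

/-- The main loop contributes `n` queries and the sorting at most `n` tournaments of `n` rounds of
`n` queries. The exponent `8` of `queryError` is generous here. -/
theorem total_error_le {n s : ℕ} (hs : 2 ≤ s) (hsn : s ≤ n) :
    (n : ENNReal) * queryError n + n * (n * (n * queryError n)) ≤
      ENNReal.ofReal (1 / (s : ℝ)) := by
  have hs' : (2 : ℝ) ≤ s := by exact_mod_cast hs
  have hn : (s : ℝ) ≤ n := by exact_mod_cast hsn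
  have hn2 : (2 : ℝ) ≤ n := hs'.trans hn
  have hq : (0 : ℝ) ≤ 1 / (n : ℝ) ^ 8 := by positivity
  rw [queryError, ← ENNReal.ofReal_natCast, ← ENNReal.ofReal_mul (by positivity),
    ← ENNReal.ofReal_mul (by positivity), ← ENNReal.ofReal_mul (by positivity),
    ← ENNReal.ofReal_add (by positivity) (by positivity)]
  refine ENNReal.ofReal_le_ofReal (le_trans ?_ (one_div_le_one_div_of_le (by linarith) hn))
  have h0 : (0 : ℝ) < n := by linarith
  rw [show (n : ℝ) * (1 / (n : ℝ) ^ 8) + n * (n * (n * (1 / (n : ℝ) ^ 8))) =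
    (n + n ^ 3) / (n : ℝ) ^ 8 by field_simp, div_le_div_iff₀ (by positivity) h0]
  have h1 : (n : ℝ) ≤ n ^ 3 := le_self_pow₀ (by linarith) (by norm_num)
  have h2 : 2 * (n : ℝ) ^ 4 ≤ n ^ 4 * n ^ 4 := by
    refine mul_le_mul_of_nonneg_right ?_ (by positivity)
    exact hn2.trans (le_self_pow₀ (by linarith) (by norm_num))
  calc ((n : ℝ) + n ^ 3) * n ≤ (n ^ 3 + n ^ 3) * n := by gcongr
    _ = 2 * (n : ℝ) ^ 4 := by ring
    _ ≤ n ^ 4 * n ^ 4 := h2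
    _ = 1 * n ^ 8 := by ring

end TopKChoice

theorem mainTheorem4 :
    ∃ (c C : ℝ) (m : ℕ → ℕ → ℕ), 0 < c ∧ 0 < C ∧
      (∀ n r : ℕ, 2 ≤ n → 2 ≤ r →
        c * ((r : ℝ) ^ 2 * Real.log n) ≤ (m n r : ℝ) ∧
          (m n r : ℝ) ≤ C * ((r : ℝ) ^ 2 * Real.log n)) ∧
      ∀ p : ℝ, 0 < p →
        ∃ ε : ℕ → ℝ, Filter.Tendsto ε Filter.atTop (nhds 0) ∧
          ∀ (n k r : ℕ), k ≤ n → 2 ≤ r →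
            ∀ (M : TopKChoice.TopKGMM n k) (sel : TopKChoice.Selector n),
              M.p = p →
              (∀ l, M.center l ≠ none) →
              0 < M.wMin →
              Real.log 3 / M.wMin ≤ M.β →
              ENNReal.ofReal (1 - ε (n - k)) ≤
                (TopKChoice.bucchoi M.oracle sel r (m n r)).toOuterMeasure
                  {out | out.size = k ∧
                    out.center.map some = List.ofFn M.center ∧
                    ∀ q ∈ out.data, q.1.card ≤ r ∧ q.2.length = m n r} := by
  refine ⟨1000, 1001, TopKChoice.sampleSize, by norm_num, by norm_num,
    fun n r hn hr => ⟨TopKChoice.le_sampleSize n r, TopKChoice.sampleSize_le hn hr⟩,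
    fun p hp => ⟨TopKChoice.algError p, TopKChoice.tendsto_algError hp, ?_⟩⟩
  intro n k r hk hr M sel hMp hc hw hβ
  -- A small gap makes the claimed probability `0`. A large gap provides both the one percent bound
  -- and `2 ≤ n`.
  by_cases hgap : TopKChoice.IsLargeGap p (n - k)
  · rw [TopKChoice.algError, if_pos hgap]
    refine TopKChoice.FailLE.le_toOuterMeasure (by positivity) ?_
    have hs : ((n + 1 - k : ℕ) : ℝ) * (3 * TopKChoice.TopKGMM.unrankedFactor n k M.p) ≤
        1 / 100 := by
      rw [TopKChoice.TopKGMM.unrankedFactor, hMp, Nat.sub_add_comm hk]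
      exact hgap.2
    have hn : 2 ≤ n := hgap.1.trans (Nat.sub_le _ _)
    have hO : TopKChoice.OracleOK M.center M.oracle r (TopKChoice.sampleSize n r)
        (TopKChoice.queryError n) := fun A hA =>
      M.failLE_query hn hr (TopKChoice.le_sampleSize n r) hc
        (M.rankedWt_zero_ge hk (M.log_three_le hw hβ) hs) hA
    exact (TopKChoice.failLE_bucchoi hO hr hc hk).mono
      (TopKChoice.total_error_le hgap.1 (Nat.sub_le _ _)) fun _ h => h
  · rw [TopKChoice.algError, if_neg hgap, sub_self, ENNReal.ofReal_zero]
    exact zero_le
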